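/- Conventions. Let $L$ be a finite first-order language. A structure *on numbers* is an $L$-structure $\mathcal{B}$ whose domain is a subset of $\omega$. Its atomic diagram is the set of all quantifier-free sentences true in $\mathcal{B}$, in the language $L$ expanded by a constant symbol for each element of $\mathcal{B}$; via a fixed effective Gödel numbering it is regarded as a subset of $\omega$. The structure $\mathcal{B}$ is identified with its atomic diagram whenever computability is concerned; in particular $\deg(\mathcal{B})$ is the Turing degree of the atomic diagram, an enumeration of $\mathcal{B}$ is a function $f:\omega\to\omega$ whose range is the atomic diagram, and a sequence $\{\mathcal{A}_i\}_{i\in\omega}$ is computable if the atomic diagrams of the $\mathcal{A}_i$ are computable uniformly in $i$. Let $D_u$ be the finite set with canonical index $u$, i.e. $u=\sum_{n\in D_u}2^n$. For $X,Y\subseteq\omega$, $Y\le_e X$ ($Y$ is enumeration reducible to $X$) means that there is a computably enumerable binary relation $E$ such that for all $y$: $y\in Y \Leftrightarrow (\exists u)[D_u\subseteq X\wedge E(y,u)]$. The isomorphism type of a countable structure $\mathcal{M}$ has Turing degree $\mathbf{d}$ if $\mathbf{d}$ is the least element of $\{\deg(\mathcal{B}):\mathcal{B}\text{ on numbers},\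 \mathcal{B}\cong\mathcal{M}\}$; it has no Turing degree if there is no least element. Theorem. Let $\mathcal{C}$ be a class of countable $L$-structures, closed under isomorphisms. Assume that there is a computable sequence $\{\mathcal{A}_i\}_{i\in\omega}$ of (possibly infinite) structures on numbers in $\mathcal{C}$ satisfying the following conditions. 1. There is a finitely generated structure $\mathcal{A}\in\mathcal{C}$ such that $\mathcal{A}$ is a substructure of $\mathcal{A}_i$ for all $i\in\omega$. 2. For every $X\subseteq\omega$ there is a structure on numbers $\mathcal{A}_X\in\mathcal{C}$ such that $\mathcal{A}$ is a substructure of $\mathcal{A}_X$, $\mathcal{A}_X\le_e X$, and for every $i\in\omega$: there is an embedding $\sigma:\mathcal{A}_i\hookrightarrow\mathcal{A}_X$ with $\sigma|_{\mathcal{A}}=\mathrm{id}$ if and only if $i\in X$. 3. Whenever $X\subseteq\omega$, $\mathcal{B}$ is a structure on numbers and $\tau:\mathcal{A}_X\to\mathcal{B}$ is an isomorphism, then from any enumeration of $\mathcal{B}$ one can effectively pass to an enumeration of the set of those $i$ for which there is an embedding $\sigma:\mathcal{A}_i\hookrightarrow\mathcal{B}$ with $(\tau^{-1}\circ\sigma)|_{\mathcal{A}}=\mathrm{id}$;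 that is, for every enumeration $f$ of $\mathcal{B}$ this set is empty or is the range of a function $g:\omega\to\omega$ computable in $f$. Then there is a structure in $\mathcal{C}$ whose isomorphism type has no Turing degree. -/

import Mathlib

open scoped FirstOrder Computability

universe u v w

noncomputable section

namespace ComputableStructures

/-! ### Sets of natural numbers: degrees, enumerations, enumeration reducibility -/

open Classical in
/-- The characteristic function of a set of natural numbers. -/
def charFun (S : Set ℕ) : ℕ → ℕ := fun n => if n ∈ S then 1 else 0

/-- The Turing degree of a set of natural numbers. -/
def setDegree (S : Set ℕ) : TuringDegree :=
  toAntisymmetrization TuringReducible (charFun S : ℕ →. ℕ)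

/-- `f` is an enumeration of `S`. -/
def IsEnumeration (f : ℕ → ℕ) (S : Set ℕ) : Prop := Set.range f = S

/-- `S` is computably enumerable relative to `f`: it is empty, or it has an enumeration
which is computable from the oracle `f`. -/
def EnumerableFrom (f : ℕ → ℕ) (S : Set ℕ) : Prop :=
  S = ∅ ∨ ∃ g : ℕ → ℕ, (g : ℕ →. ℕ) ≤ᵀ (f : ℕ →. ℕ) ∧ IsEnumeration g S

/-- The finite set with canonical index `u`, the positions of the digit `1` in the binary
expansion of `u`. -/
def canonicalFiniteSet (u : ℕ) : Set ℕ := {n | u.testBit n = true}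

/-- Enumeration reducibility `X ≤ₑ Y`. -/
def EnumReducible (X Y : Set ℕ) : Prop :=
  ∃ E : ℕ → ℕ → Prop, REPred (fun p : ℕ × ℕ => E p.1 p.2) ∧
    ∀ x, x ∈ X ↔ ∃ u, canonicalFiniteSet u ⊆ Y ∧ E x u

/-! ### Gödel numbering of terms and sentences -/

/-- Gödel numbers of terms, from numberings `fc` of the function symbols of each arity and `vc`
of the variables. -/
def termCode {L : FirstOrder.Language.{u, v}} {α : Type w} (fc : ∀ l, L.Functions l → ℕ) (vc : α → ℕ) :
    L.Term α → ℕ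
  | .var a => Nat.pair 0 (vc a)
  | .func (l := l) f ts =>
      Nat.pair 1 (Nat.pair l (Nat.pair (fc l f)
        (Encodable.encode (List.ofFn fun i => termCode fc vc (ts i)))))

/-- Numbering of the variables of a formula whose only variables are bound ones. -/
def boundVarCode {n : ℕ} : Empty ⊕ Fin n → ℕ := Sum.elim Empty.elim Fin.val

/-- Gödel numbers of formulas without free variables named by a type, from numberings `fc`, `rc`
of the function and relation symbols of each arity. -/
def formulaCode {L : FirstOrder.Language.{u, v}} (fc : ∀ l, L.Functions l → ℕ)
    (rc : ∀ l, L.Relations l → ℕ) : ∀ {n : ℕ}, L.BoundedFormula Empty n → ℕ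
  | _, .falsum => Nat.pair 0 0
  | _, .equal s t => Nat.pair 1 (Nat.pair (termCode fc boundVarCode s) (termCode fc boundVarCode t))
  | _, .rel (l := l) R ts =>
      Nat.pair 2 (Nat.pair l (Nat.pair (rc l R)
        (Encodable.encode (List.ofFn fun i => termCode fc boundVarCode (ts i)))))
  | _, .imp φ ψ => Nat.pair 3 (Nat.pair (formulaCode fc rc φ) (formulaCode fc rc ψ))
  | _, .all φ => Nat.pair 4 (formulaCode fc rc φ)

/-! ### Structures whose domain consists of natural numbers -/

/-- An `L`-structure whose domain is a set of natural numbers. -/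
structure OmegaStructure (L : FirstOrder.Language.{u, v}) where
  /-- the domain -/
  dom : Set ℕ
  /-- the interpretation of the symbols of `L` -/
  str : L.Structure dom

instance {L : FirstOrder.Language.{u, v}} (A : OmegaStructure L) : L.Structure A.dom := A.str

namespace OmegaStructure

variable {L : FirstOrder.Language.{u, v}}

/-- The structure as a member of the class of all structures. -/
def toBundled (A : OmegaStructure L) : CategoryTheory.Bundled.{0} L.Structure := ⟨A.dom, A.str⟩

/-- Numbering of the function symbols of `L` expanded by a constant symbol for each element of a
set of natural numbers; the constant symbol for `a` is numbered by means of the number `a`. -/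
def constFunctionCode [∀ n, Encodable (L.Functions n)] (D : Set ℕ) :
    ∀ l, (L[[D]]).Functions l → ℕ
  | _, Sum.inl f => Nat.pair 0 (Encodable.encode f)
  | 0, Sum.inr a => Nat.pair 1 (Subtype.val (p := (· ∈ D)) a)
  | _ + 1, Sum.inr a => PEmpty.elim a

/-- Numbering of the relation symbols of `L` expanded by constant symbols. -/
def constRelationCode [∀ n, Encodable (L.Relations n)] (D : Set ℕ) :
    ∀ l, (L[[D]]).Relations l → ℕ
  | _, Sum.inl R => Encodable.encode R
  | _, Sum.inr R => Empty.elim R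

/-- The Gödel number of a sentence of `L` expanded by a constant symbol for each element of `D`. -/
def sentenceCode [∀ n, Encodable (L.Functions n)] [∀ n, Encodable (L.Relations n)] (D : Set ℕ)
    (φ : (L[[D]]).Sentence) : ℕ :=
  formulaCode (constFunctionCode D) (constRelationCode D) φ

/-- The atomic diagram of `A`: the set of (Gödel numbers of) all quantifier-free sentences, in the
language expanded by a constant symbol for each element of `A`, which are true in `A`. -/
def atomicDiagram [∀ n, Encodable (L.Functions n)] [∀ n, Encodable (L.Relations n)]
    (A : OmegaStructure L) : Set ℕ :=
  {c | ∃ φ : (L[[A.dom]]).Sentence,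
    FirstOrder.Language.BoundedFormula.IsQF φ ∧ A.dom ⊨ φ ∧ sentenceCode A.dom φ = c}

/-- The Turing degree of `A`, that is, of its atomic diagram. -/
def degree [∀ n, Encodable (L.Functions n)] [∀ n, Encodable (L.Relations n)]
    (A : OmegaStructure L) : TuringDegree := setDegree A.atomicDiagram

/-- `A` is a substructure of `B`: its domain is a subset of that of `B`, and the inclusion map is
an embedding of `L`-structures. -/
def IsSubstructure (A B : OmegaStructure L) : Prop :=
  ∃ e : A.dom ↪[L] B.dom, ∀ a, (e a : ℕ) = a

/-- A sequence of structures is computable if their atomic diagrams are uniformly computable. -/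
def ComputableSequence [∀ n, Encodable (L.Functions n)] [∀ n, Encodable (L.Relations n)]
    (A : ℕ → OmegaStructure L) : Prop :=
  ComputablePred fun p : ℕ × ℕ => p.2 ∈ (A p.1).atomicDiagram

end OmegaStructure

/-- The Turing degree spectrum of a structure `M`: the degrees of its isomorphic copies. -/
def degreeSpectrum {L : FirstOrder.Language.{u, v}} [∀ n, Encodable (L.Functions n)]
    [∀ n, Encodable (L.Relations n)] (M : CategoryTheory.Bundled.{0} L.Structure) :
    Set TuringDegree :=
  {d | ∃ B : OmegaStructure L, Nonempty (B.dom ≃[L] M) ∧ B.degree = d}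

/-- `d` is the Turing degree of the isomorphism type of `M`. -/
def IsDegreeOfIsomorphismType {L : FirstOrder.Language.{u, v}} [∀ n, Encodable (L.Functions n)]
    [∀ n, Encodable (L.Relations n)] (M : CategoryTheory.Bundled.{0} L.Structure)
    (d : TuringDegree) : Prop :=
  IsLeast (degreeSpectrum M) d

end ComputableStructures

end

/-!
The structure without a degree is `AX X` for the range `X` of a function `f` such that

* `X` is not the range of a computable function, and
* `X` has a second enumeration `g` such that every function computable both from `f` and from `g`
  is computable.

Every enumeration `k` of `X` computes a copy of `AX X`. Indeed, the atomic diagram of `AX X` is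
enumeration reducible to `X`, so `k` computes an enumeration of it
(`EnumReducible.exists_enumeration`), and an enumeration of the atomic diagram of a structure
computes a copy (`OmegaStructure.exists_copy_turingReducible`). Hence, if `B` were a copy of `AX X`
of least degree, its atomic diagram would be computable from `f` and from `g`, so it would be
computable. Then it would have a computable enumeration, and by the hypothesis on copies so would
the set of the indices of the structures which embed into `B` over `A`. This set is `X`, a
contradiction.

The pair `f`, `g` is constructed by finite extension (`exists_minimal_pair_of_enumerations`), that
is, from a sufficiently generic ideal of conditions. A condition consists of initial segments of
`f` and `g` and of finitely many numbers kept out of `X`. Given two oracle computations, either some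
condition in the ideal makes them disagree, or some condition has no extension which makes them
disagree; in the latter case their common value can be computed by running the first of them on
arbitrary finite extensions of that condition. What is needed from the theory of oracles is the use
principle (`exists_partrec_use`): an oracle computation is the limit of a single partial recursive
function along the initial segments of the oracle. It also shows that countably many requirements
suffice. Conversely, a computable search through the initial segments of an oracle is computable
from the oracle (`turingReducible_of_search`); all reductions to an oracle below are of this form.

An enumeration of an atomic diagram enumerates the domain, since it tells which sentences `a = a`
belong to the diagram. The copy takes as its elements the stages at which a new element of the
domain appears, so its domain is computable from the enumeration, whether finite or infinite. To
decide the atomic diagram of the copy, a Gödel number is translated by replacing the constants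
(`formulaTransl`, a primitive recursion which also recognizes the Gödel numbers of quantifier-free
sentences, because the language is finite), and then either the translation or its negation is found
in the enumeration.
-/

namespace ComputableStructures

/-! ### Oracle computations and initial segments of the oracle -/

/-- The finite sequence of the first `n` values of `f`. -/
def initialSegment (f : ℕ → ℕ) (n : ℕ) : List ℕ := (List.range n).map f

theorem initialSegment_succ (f : ℕ → ℕ) (n : ℕ) :
    initialSegment f (n + 1) = initialSegment f n ++ [f n] := by
  simp [initialSegment, List.range_succ]

@[simp] theorem length_initialSegment (f : ℕ → ℕ) (n : ℕ) : (initialSegment f n).length = n := by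
  simp [initialSegment]

theorem mem_initialSegment {f : ℕ → ℕ} {n y : ℕ} :
    y ∈ initialSegment f n ↔ ∃ m < n, f m = y := by
  simp [initialSegment]

theorem initialSegment_prefix (f : ℕ → ℕ) {m n : ℕ} (h : m ≤ n) :
    initialSegment f m <+: initialSegment f n := by
  induction h with
  | refl => exact List.prefix_rfl
  | step _ ih => exact ih.trans ⟨[f _], (initialSegment_succ f _).symm⟩

theorem take_initialSegment (f : ℕ → ℕ) {m n : ℕ} (h : m ≤ n) :
    (initialSegment f n).take m = initialSegment f m := by
  simp [initialSegment, ← List.map_take, List.take_range, h]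

theorem getElem?_initialSegment {f : ℕ → ℕ} {n x : ℕ} :
    (initialSegment f n)[x]? = if x < n then some (f x) else none := by
  split_ifs with h <;> simp [initialSegment, h]

theorem mem_rfind_eq_zero (p : ℕ → Part ℕ) (y : ℕ) :
    (y ∈ Nat.rfind fun n => (fun z => decide (z = 0)) <$> p n) ↔
      0 ∈ p y ∧ ∀ j < y, ∃ a ∈ p j, a ≠ 0 := by
  refine Nat.mem_rfind.trans (and_congr ?_ (forall_congr' fun j => forall_congr' fun _ => ?_))
  · simp
  · simp

/-- The use principle: an oracle computation is the limit of one partial recursive function along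
the initial segments of its oracle. -/
theorem exists_partrec_use {f : ℕ → ℕ} {h : ℕ →. ℕ} (H : h ≤ᵀ (f : ℕ →. ℕ)) :
    ∃ ψ : List ℕ → ℕ →. ℕ, Partrec₂ ψ ∧
      (∀ σ τ x y, σ <+: τ → y ∈ ψ σ x → y ∈ ψ τ x) ∧
      ∀ x y, y ∈ h x ↔ ∃ n, y ∈ ψ (initialSegment f n) x := by
  -- functions that ignore the oracle
  have base : ∀ k : ℕ →. ℕ, Nat.Partrec k → ∃ ψ : List ℕ → ℕ →. ℕ, Partrec₂ ψ ∧
      (∀ σ τ x y, σ <+: τ → y ∈ ψ σ x → y ∈ ψ τ x) ∧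
      ∀ x y, y ∈ k x ↔ ∃ n, y ∈ ψ (initialSegment f n) x := fun k hk =>
    ⟨fun _ x => k x, (Partrec.nat_iff.2 hk).comp Computable.snd, fun _ _ _ _ _ h => h,
      fun x y => by simp⟩
  rw [TuringReducible, RecursiveIn.iff_nat] at H
  induction H with
  | zero => exact base _ .zero
  | succ => exact base _ .succ
  | left => exact base _ .left
  | right => exact base _ .right
  | oracle g hg =>
    obtain rfl : g = _ := hg
    refine ⟨fun σ x => (σ[x]? : Part ℕ), Computable.ofOption Computable.list_getElem?, ?_, ?_⟩
    · rintro σ _ x y ⟨t, rfl⟩ hy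
      simp only [Part.mem_ofOption, Option.mem_def] at hy ⊢
      obtain ⟨hx, rfl⟩ := List.getElem?_eq_some_iff.1 hy
      rw [List.getElem?_append_left hx, hy]
    · intro x y
      simp only [Part.mem_ofOption, Option.mem_def, getElem?_initialSegment, PFun.coe_val,
        Part.mem_some_iff]
      constructor
      · rintro rfl
        exact ⟨x + 1, by simp⟩
      · rintro ⟨n, hn⟩
        split_ifs at hn
        simpa using hn.symm
  | @pair k₁ k₂ _ _ ih₁ ih₂ =>
    obtain ⟨ψ₁, c₁, m₁, e₁⟩ := ih₁
    obtain ⟨ψ₂, c₂, m₂, e₂⟩ := ih₂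
    refine ⟨fun σ x => (ψ₁ σ x).bind fun a => (ψ₂ σ x).map fun b => Nat.pair a b, ?_, ?_, ?_⟩
    · exact c₁.bind ((c₂.comp (Computable.fst.comp Computable.fst)
        (Computable.snd.comp Computable.fst)).map
        (Primrec₂.natPair.comp (Primrec.snd.comp Primrec.fst) Primrec.snd).to_comp.to₂)
    · intro σ τ x y hστ
      simp only [Part.mem_bind_iff, Part.mem_map_iff]
      rintro ⟨a, ha, b, hb, rfl⟩
      exact ⟨a, m₁ _ _ _ _ hστ ha, b, m₂ _ _ _ _ hστ hb, rfl⟩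
    · intro x y
      simp only [Part.mem_bind_iff, Part.mem_map_iff, Seq.seq, Part.map_eq_map]
      constructor
      · rintro ⟨_, ⟨a, ha, rfl⟩, b, hb, rfl⟩
        obtain ⟨n₁, h₁⟩ := (e₁ _ _).1 ha
        obtain ⟨n₂, h₂⟩ := (e₂ _ _).1 hb
        exact ⟨max n₁ n₂, a, m₁ _ _ _ _ (initialSegment_prefix f (le_max_left _ _)) h₁, b,
          m₂ _ _ _ _ (initialSegment_prefix f (le_max_right _ _)) h₂, rfl⟩
      · rintro ⟨n, a, ha, b, hb, rfl⟩
        exact ⟨_, ⟨a, (e₁ _ _).2 ⟨n, ha⟩, rfl⟩, b, (e₂ _ _).2 ⟨n, hb⟩, rfl⟩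
  | @comp k₁ k₂ _ _ ih₁ ih₂ =>
    obtain ⟨ψ₁, c₁, m₁, e₁⟩ := ih₁
    obtain ⟨ψ₂, c₂, m₂, e₂⟩ := ih₂
    refine ⟨fun σ x => (ψ₂ σ x).bind fun a => ψ₁ σ a, ?_, ?_, ?_⟩
    · exact c₂.bind (c₁.comp (Computable.fst.comp Computable.fst) Computable.snd)
    · intro σ τ x y hστ
      simp only [Part.mem_bind_iff]
      rintro ⟨a, ha, hb⟩
      exact ⟨a, m₂ _ _ _ _ hστ ha, m₁ _ _ _ _ hστ hb⟩
    · intro x y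
      refine (Part.mem_bind_iff (f := k₂ x) (g := k₁)).trans (Iff.trans ?_
        (exists_congr fun n => Part.mem_bind_iff.symm))
      constructor
      · rintro ⟨a, ha, hb⟩
        obtain ⟨n₁, h₁⟩ := (e₂ _ _).1 ha
        obtain ⟨n₂, h₂⟩ := (e₁ _ _).1 hb
        exact ⟨max n₁ n₂, a, m₂ _ _ _ _ (initialSegment_prefix f (le_max_left _ _)) h₁,
          m₁ _ _ _ _ (initialSegment_prefix f (le_max_right _ _)) h₂⟩
      · rintro ⟨n, a, ha, hb⟩
        exact ⟨a, (e₂ _ _).2 ⟨n, ha⟩, (e₁ _ _).2 ⟨n, hb⟩⟩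
  | @prec k₁ k₂ _ _ ih₁ ih₂ =>
    obtain ⟨ψ₁, c₁, m₁, e₁⟩ := ih₁
    obtain ⟨ψ₂, c₂, m₂, e₂⟩ := ih₂
    have mono : ∀ (σ τ : List ℕ) (a m y : ℕ), σ <+: τ →
        y ∈ (m.rec (ψ₁ σ a) fun z IH => IH.bind fun i => ψ₂ σ (Nat.pair a (Nat.pair z i)) :
          Part ℕ) →
        y ∈ (m.rec (ψ₁ τ a) fun z IH => IH.bind fun i => ψ₂ τ (Nat.pair a (Nat.pair z i)) :
          Part ℕ) := by
      intro σ τ a m y hστ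
      induction m generalizing y with
      | zero => exact m₁ _ _ _ _ hστ
      | succ m ih =>
        simp only [Part.mem_bind_iff]
        rintro ⟨i, hi, hy⟩
        exact ⟨i, ih _ hi, m₂ _ _ _ _ hστ hy⟩
    refine ⟨fun σ x => x.unpair.2.rec (ψ₁ σ x.unpair.1) fun z IH => IH.bind fun i =>
        ψ₂ σ (Nat.pair x.unpair.1 (Nat.pair z i)), ?_, fun σ τ x y => mono σ τ _ _ y, ?_⟩
    · have cu : Computable fun p : List ℕ × ℕ => p.2.unpair :=
        Computable.unpair.comp Computable.snd
      refine Partrec.nat_rec (h := fun (p : List ℕ × ℕ) (q : ℕ × ℕ) =>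
          ψ₂ p.1 (Nat.pair p.2.unpair.1 (Nat.pair q.1 q.2))) (Computable.snd.comp cu)
        (c₁.comp Computable.fst (Computable.fst.comp cu)) ?_
      refine c₂.comp (Computable.fst.comp Computable.fst) ?_
      exact Primrec₂.natPair.to_comp.comp (Computable.fst.comp (cu.comp Computable.fst))
        (Primrec₂.natPair.to_comp.comp (Computable.fst.comp Computable.snd)
          (Computable.snd.comp Computable.snd))
    · intro x
      obtain ⟨a, m, rfl⟩ : ∃ a m, x = Nat.pair a m := ⟨_, _, (Nat.pair_unpair x).symm⟩
      simp only [Nat.unpair_pair]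
      induction m with
      | zero => exact fun y => e₁ a y
      | succ m ih =>
        intro y
        simp only [Part.bind_eq_bind, Part.mem_bind_iff] at ih ⊢
        constructor
        · rintro ⟨i, hi, hy⟩
          obtain ⟨n₁, h₁⟩ := (ih _).1 hi
          obtain ⟨n₂, h₂⟩ := (e₂ _ _).1 hy
          exact ⟨max n₁ n₂, i, mono _ _ _ _ _ (initialSegment_prefix f (le_max_left _ _)) h₁,
            m₂ _ _ _ _ (initialSegment_prefix f (le_max_right _ _)) h₂⟩
        · rintro ⟨n, i, hi, hy⟩
          exact ⟨i, (ih _).2 ⟨n, hi⟩, (e₂ _ _).2 ⟨n, hy⟩⟩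
  | @rfind k _ ih =>
    obtain ⟨ψ, c, m, e⟩ := ih
    refine ⟨fun σ x => Nat.rfind fun n => (fun z => decide (z = 0)) <$> ψ σ (Nat.pair x n),
      ?_, ?_, ?_⟩
    · refine Partrec.rfind ?_
      have := c.comp
        (Computable.fst.comp Computable.fst : Computable fun p : (List ℕ × ℕ) × ℕ => p.1.1)
        (Primrec₂.natPair.to_comp.comp (Computable.snd.comp Computable.fst) Computable.snd)
      exact this.map (Primrec.eq.decide.comp Primrec.snd (Primrec.const 0)).to_comp.to₂
    · intro σ τ x y hστ hy
      obtain ⟨h₀, h₁⟩ := (mem_rfind_eq_zero (fun n => ψ σ (Nat.pair x n)) y).1 hy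
      refine (mem_rfind_eq_zero (fun n => ψ τ (Nat.pair x n)) y).2 ⟨m _ _ _ _ hστ h₀, fun j hj => ?_⟩
      obtain ⟨a, ha, ha'⟩ := h₁ j hj
      exact ⟨a, m _ _ _ _ hστ ha, ha'⟩
    · intro x y
      refine (mem_rfind_eq_zero (fun n => k (Nat.pair x n)) y).trans (Iff.trans ?_ (exists_congr
        fun i => (mem_rfind_eq_zero (fun n => ψ (initialSegment f i) (Nat.pair x n)) y).symm))
      constructor
      · rintro ⟨hz, hy⟩
        -- only finitely many values have to be computed before the search stops
        have : ∀ j, ∃ n, j < y → ∃ a, a ∈ ψ (initialSegment f n) (Nat.pair x j) ∧ a ≠ 0 := by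
          intro j
          by_cases hj : j < y
          · obtain ⟨a, ha, ha'⟩ := hy j hj
            obtain ⟨n, hn⟩ := (e _ _).1 ha
            exact ⟨n, fun _ => ⟨a, hn, ha'⟩⟩
          · exact ⟨0, fun h => absurd h hj⟩
        choose N hN using this
        obtain ⟨n, hn⟩ := (e _ _).1 hz
        refine ⟨max n ((Finset.range y).sup N),
          m _ _ _ _ (initialSegment_prefix f (le_max_left _ _)) hn, fun j hj => ?_⟩
        obtain ⟨a, ha, ha'⟩ := hN j hj
        refine ⟨a, m _ _ _ _ (initialSegment_prefix f ?_) ha, ha'⟩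
        exact (Finset.le_sup (f := N) (Finset.mem_range.2 hj)).trans (le_max_right _ _)
      · rintro ⟨n, hz, hy⟩
        refine ⟨(e _ _).2 ⟨n, hz⟩, fun j hj => ?_⟩
        obtain ⟨a, ha, ha'⟩ := hy j hj
        exact ⟨a, (e _ _).2 ⟨n, ha⟩, ha'⟩

theorem recursiveIn_comp {O : Set (ℕ →. ℕ)} {a b : ℕ → ℕ}
    (ha : Nat.RecursiveIn O (a : ℕ →. ℕ)) (hb : Nat.RecursiveIn O (b : ℕ →. ℕ)) :
    Nat.RecursiveIn O ((fun n => a (b n) : ℕ → ℕ) : ℕ →. ℕ) :=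
  (ha.comp hb).of_eq fun n => Part.bind_some (b n) (a : ℕ →. ℕ)

theorem recursiveIn_pair {O : Set (ℕ →. ℕ)} {a b : ℕ → ℕ}
    (ha : Nat.RecursiveIn O (a : ℕ →. ℕ)) (hb : Nat.RecursiveIn O (b : ℕ →. ℕ)) :
    Nat.RecursiveIn O ((fun n => Nat.pair (a n) (b n) : ℕ → ℕ) : ℕ →. ℕ) :=
  (ha.pair hb).of_eq fun n => by simp [Seq.seq]

theorem _root_.Computable.natRecursiveIn {O : Set (ℕ →. ℕ)} {a : ℕ → ℕ} (ha : Computable a) :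
    Nat.RecursiveIn O (a : ℕ →. ℕ) :=
  Nat.Partrec.recursiveIn (Partrec.nat_iff.1 ha.partrec)

theorem initialSegment_recursiveIn (f : ℕ → ℕ) :
    Nat.RecursiveIn {(f : ℕ →. ℕ)}
      ((fun n => Encodable.encode (initialSegment f n) : ℕ → ℕ) : ℕ →. ℕ) := by
  have hc : Computable fun q : ℕ =>
      Encodable.encode (Denumerable.ofNat (List ℕ) q.unpair.1 ++ [q.unpair.2]) :=
    (Primrec.encode.comp (Primrec.list_concat.comp
      ((Primrec.ofNat (List ℕ)).comp (Primrec.fst.comp Primrec.unpair))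
      (Primrec.snd.comp Primrec.unpair))).to_comp
  have hl : Computable fun q : ℕ => q.unpair.1 := (Primrec.fst.comp Primrec.unpair).to_comp
  have hr : Computable fun q : ℕ => q.unpair.2 := (Primrec.snd.comp Primrec.unpair).to_comp
  -- one step of the recursion: append the value of the oracle to the segment found so far
  have hstep := recursiveIn_comp (O := {(f : ℕ →. ℕ)}) hc.natRecursiveIn
    (recursiveIn_pair (hr.comp hr).natRecursiveIn
      (recursiveIn_comp (.oracle (f : ℕ →. ℕ) rfl) (hl.comp hr).natRecursiveIn))
  have hrec := (Nat.RecursiveIn.comp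
    ((Computable.const 0).natRecursiveIn.prec hstep)
    (recursiveIn_pair (Computable.const 0).natRecursiveIn Computable.id.natRecursiveIn))
  refine hrec.of_eq fun n => (Part.bind_some (Nat.pair 0 n) _).trans ?_
  simp only [Nat.unpair_pair]
  induction n with
  | zero => rfl
  | succ n ih =>
    refine (congrArg (fun o : Part ℕ => o.bind _) ih).trans ((Part.bind_some _ _).trans ?_)
    simp [initialSegment_succ]

/-- If the value `h x` can be found by a computable search through the finite initial segments of
`f`, then `h` is computable from `f`. -/
theorem turingReducible_of_search {f h : ℕ → ℕ} {G : List ℕ → ℕ → Option ℕ} (hG : Computable₂ G)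
    (sound : ∀ n x y, G (initialSegment f n) x = some y → y = h x)
    (complete : ∀ x, ∃ n, (G (initialSegment f n) x).isSome) :
    (h : ℕ →. ℕ) ≤ᵀ (f : ℕ →. ℕ) := by
  rw [TuringReducible, RecursiveIn.iff_nat]
  have hG' : Computable fun q : ℕ => G (Denumerable.ofNat (List ℕ) q.unpair.1) q.unpair.2 :=
    hG.comp ((Primrec.ofNat (List ℕ)).comp (Primrec.fst.comp Primrec.unpair)).to_comp
      (Primrec.snd.comp Primrec.unpair).to_comp
  have htest : Computable fun q : ℕ =>
      if (G (Denumerable.ofNat (List ℕ) q.unpair.1) q.unpair.2).isSome then 0 else 1 :=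
    ((Primrec.ite (c := fun o : Option ℕ => o.isSome = true)
      (Primrec.eq.comp Primrec.option_isSome (Primrec.const true))
      (Primrec.const 0) (Primrec.const 1)).to_comp.comp hG').of_eq fun q => by simp
  have hval : Computable fun q : ℕ =>
      (G (Denumerable.ofNat (List ℕ) q.unpair.1) q.unpair.2).getD 0 :=
    (Primrec.option_getD.comp Primrec.id (Primrec.const 0)).to_comp.comp hG'
  have hl : Computable fun q : ℕ => q.unpair.1 := (Primrec.fst.comp Primrec.unpair).to_comp
  have hr : Computable fun q : ℕ => q.unpair.2 := (Primrec.snd.comp Primrec.unpair).to_comp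
  have hseg := initialSegment_recursiveIn f
  classical
  -- the least stage at which the search succeeds
  let N : ℕ → ℕ := fun x => Nat.find (complete x)
  have hN : Nat.RecursiveIn {(f : ℕ →. ℕ)} (N : ℕ →. ℕ) := by
    refine (Nat.RecursiveIn.rfind (recursiveIn_comp htest.natRecursiveIn
      (recursiveIn_pair (recursiveIn_comp hseg hr.natRecursiveIn) hl.natRecursiveIn))).of_eq_tot
      fun x => ?_
    refine (mem_rfind_eq_zero (fun n => Part.some _) _).2 ⟨?_, fun j hj => ⟨_, Part.mem_some _, ?_⟩⟩
    · simpa [← Option.isSome_iff_ne_none] using Nat.find_spec (complete x)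
    · simpa using Nat.find_min (complete x) hj
  refine (recursiveIn_comp hval.natRecursiveIn
    (recursiveIn_pair (recursiveIn_comp hseg hN) Computable.id.natRecursiveIn)).of_eq fun x => ?_
  obtain ⟨y, hy⟩ := Option.isSome_iff_exists.1 (Nat.find_spec (complete x))
  have := sound _ _ _ hy
  simp [N, hy, this]

/-! ### A generic pair of enumerations -/

theorem exists_code_eval_encode {ψ : List ℕ → ℕ →. ℕ} (hψ : Partrec₂ ψ) :
    ∃ c : Nat.Partrec.Code, ∀ σ x, c.eval (Encodable.encode (σ, x)) = ψ σ x := by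
  obtain ⟨c, hc⟩ := Nat.Partrec.Code.exists_code.1 hψ
  refine ⟨c, fun σ x => ?_⟩
  simp only [hc, Encodable.encodek, Part.coe_some, Part.bind_some]
  exact Part.map_id' (fun _ => rfl) _

/-- A directed family of finite sequences of unbounded length has a common infinite extension. -/
theorem exists_common_extension {S : Set (List ℕ)}
    (hdir : ∀ σ ∈ S, ∀ τ ∈ S, ∃ ρ ∈ S, σ <+: ρ ∧ τ <+: ρ) (hlen : ∀ n, ∃ σ ∈ S, n < σ.length) :
    ∃ f : ℕ → ℕ, ∀ σ ∈ S, σ = initialSegment f σ.length := by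
  choose s hs hn using hlen
  refine ⟨fun n => (s n)[n]'(hn n), fun σ hσ => List.ext_getElem (by simp) fun i hi _ => ?_⟩
  obtain ⟨ρ, -, h₁, h₂⟩ := hdir σ hσ (s i) (hs i)
  simp only [initialSegment, List.getElem_map, List.getElem_range]
  rw [h₁.getElem hi, h₂.getElem (hn i)]

/-- A condition for constructing two enumerations of one set: initial segments of both of them,
and finitely many numbers which are kept out of the set. -/
structure EnumerationPair where
  /-- the initial segment of the first enumeration -/
  left : List ℕ
  /-- the initial segment of the second enumeration -/
  right : List ℕ
  /-- the numbers which must not be enumerated -/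
  avoid : Finset ℕ
  left_notMem : ∀ a ∈ left, a ∉ avoid
  right_notMem : ∀ a ∈ right, a ∉ avoid

namespace EnumerationPair

instance : Preorder EnumerationPair where
  le p q := p.left <+: q.left ∧ p.right <+: q.right ∧ p.avoid ⊆ q.avoid
  le_refl p := ⟨List.prefix_rfl, List.prefix_rfl, subset_rfl⟩
  le_trans _ _ _ h h' := ⟨h.1.trans h'.1, h.2.1.trans h'.2.1, h.2.2.trans h'.2.2⟩

/-- Enumerate one more number on both sides. -/
def snoc (p : EnumerationPair) (a : ℕ) (ha : a ∉ p.avoid) : EnumerationPair where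
  left := p.left ++ [a]
  right := p.right ++ [a]
  avoid := p.avoid
  left_notMem b hb := by
    rcases List.mem_append.1 hb with hb | hb
    · exact p.left_notMem b hb
    · rwa [List.mem_singleton.1 hb]
  right_notMem b hb := by
    rcases List.mem_append.1 hb with hb | hb
    · exact p.right_notMem b hb
    · rwa [List.mem_singleton.1 hb]

theorem le_snoc (p : EnumerationPair) (a : ℕ) (ha : a ∉ p.avoid) : p ≤ p.snoc a ha :=
  ⟨⟨_, rfl⟩, ⟨_, rfl⟩, subset_rfl⟩

/-- Keep one more number out of the set. -/
def ban (p : EnumerationPair) (a : ℕ) (hl : a ∉ p.left) (hr : a ∉ p.right) : EnumerationPair where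
  left := p.left
  right := p.right
  avoid := insert a p.avoid
  left_notMem b hb := by
    rw [Finset.mem_insert, not_or]
    exact ⟨fun h => hl (h ▸ hb), p.left_notMem b hb⟩
  right_notMem b hb := by
    rw [Finset.mem_insert, not_or]
    exact ⟨fun h => hr (h ▸ hb), p.right_notMem b hb⟩

theorem le_ban (p : EnumerationPair) (a : ℕ) (hl : a ∉ p.left) (hr : a ∉ p.right) :
    p ≤ p.ban a hl hr :=
  ⟨List.prefix_rfl, List.prefix_rfl, Finset.subset_insert _ _⟩

theorem exists_fresh (p : EnumerationPair) : ∃ a, a ∉ p.avoid ∧ a ∉ p.left ∧ a ∉ p.right := by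
  obtain ⟨a, ha⟩ := Infinite.exists_notMem_finset (p.avoid ∪ p.left.toFinset ∪ p.right.toFinset)
  exact ⟨a, by simpa [not_or, and_assoc] using ha⟩

theorem isCofinal_length (n : ℕ) :
    IsCofinal {p : EnumerationPair | n < p.left.length ∧ n < p.right.length} := by
  induction n with
  | zero =>
    intro p
    obtain ⟨a, ha, -⟩ := p.exists_fresh
    exact ⟨p.snoc a ha, by simp [snoc], p.le_snoc a ha⟩
  | succ n ih =>
    intro p
    obtain ⟨q, hq, hpq⟩ := ih p
    obtain ⟨a, ha, -⟩ := q.exists_fresh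
    refine ⟨q.snoc a ha, ?_, hpq.trans (q.le_snoc a ha)⟩
    obtain ⟨h₁, h₂⟩ := hq
    exact ⟨by simp [snoc, h₁], by simp [snoc, h₂]⟩

theorem isCofinal_decide (a : ℕ) :
    IsCofinal {p : EnumerationPair | a ∈ p.avoid ∨ a ∈ p.left ∧ a ∈ p.right} := by
  intro p
  by_cases ha : a ∈ p.avoid
  · exact ⟨p, .inl ha, le_rfl⟩
  · exact ⟨p.snoc a ha, .inr ⟨by simp [snoc], by simp [snoc]⟩, p.le_snoc a ha⟩

/-- The range of the generic enumerations can be made different from any given set, by a number on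
which nothing has been decided yet. -/
theorem isCofinal_differ (S : Set ℕ) :
    IsCofinal {p : EnumerationPair | (∃ a ∈ p.avoid, a ∈ S) ∨ ∃ a ∈ p.left, a ∉ S} := by
  intro p
  obtain ⟨a, ha, hl, hr⟩ := p.exists_fresh
  by_cases hS : a ∈ S
  · exact ⟨p.ban a hl hr, .inl ⟨a, Finset.mem_insert_self _ _, hS⟩, p.le_ban a hl hr⟩
  · exact ⟨p.snoc a ha, .inr ⟨a, by simp [snoc], hS⟩, p.le_snoc a ha⟩

/-- The two computations, with the segments of the condition as oracles, disagree somewhere. -/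
def Splits (c d : Nat.Partrec.Code) (p : EnumerationPair) : Prop :=
  ∃ x y z : ℕ, y ∈ c.eval (Encodable.encode (p.left, x)) ∧
    z ∈ d.eval (Encodable.encode (p.right, x)) ∧ y ≠ z

theorem isCofinal_splits (c d : Nat.Partrec.Code) :
    IsCofinal {p : EnumerationPair | p.Splits c d ∨ ∀ q, p ≤ q → ¬ q.Splits c d} := by
  intro p
  by_cases h : ∃ q, p ≤ q ∧ q.Splits c d
  · obtain ⟨q, hq, hs⟩ := h
    exact ⟨q, .inl hs, hq⟩
  · exact ⟨p, .inr fun q hq hs => h ⟨q, hq, hs⟩, le_rfl⟩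

/-- The countably many sets of conditions which a sufficiently generic pair of enumerations has
to meet. -/
def requirement :
    ℕ ⊕ ℕ ⊕ Nat.Partrec.Code ⊕ (Nat.Partrec.Code × Nat.Partrec.Code) →
      Order.Cofinal EnumerationPair
  | .inl n => ⟨_, isCofinal_length n⟩
  | .inr (.inl a) => ⟨_, isCofinal_decide a⟩
  | .inr (.inr (.inl c)) => ⟨_, isCofinal_differ {y | ∃ x, y ∈ c.eval x}⟩
  | .inr (.inr (.inr (c, d))) => ⟨_, isCofinal_splits c d⟩

end EnumerationPair

open EnumerationPair in
/-- There is a set, not the range of a computable function, with two enumerations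
which form a minimal pair: what both of them compute is computable. -/
theorem exists_minimal_pair_of_enumerations :
    ∃ f g : ℕ → ℕ, Set.range f = Set.range g ∧
      (∀ h : ℕ → ℕ, Computable h → Set.range h ≠ Set.range f) ∧
      ∀ Z : ℕ → ℕ, (Z : ℕ →. ℕ) ≤ᵀ (f : ℕ →. ℕ) → (Z : ℕ →. ℕ) ≤ᵀ (g : ℕ →. ℕ) →
        Computable Z := by
  let I := Order.idealOfCofinals ⟨[], [], ∅, by simp, by simp⟩ requirement
  have meets := Order.cofinal_meets_idealOfCofinals ⟨[], [], ∅, by simp, by simp⟩ requirement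
  have hlen : ∀ n, ∃ p ∈ I, n < p.left.length ∧ n < p.right.length := fun n =>
    let ⟨p, hp, hI⟩ := meets (.inl n)
    ⟨p, hI, hp⟩
  have hdec : ∀ a, ∃ p ∈ I, a ∈ p.avoid ∨ a ∈ p.left ∧ a ∈ p.right := fun a =>
    let ⟨p, hp, hI⟩ := meets (.inr (.inl a))
    ⟨p, hI, hp⟩
  obtain ⟨f, hf⟩ : ∃ f : ℕ → ℕ, ∀ p ∈ I, p.left = initialSegment f p.left.length := by
    obtain ⟨f, hf⟩ := exists_common_extension (S := left '' (I : Set EnumerationPair))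
      (by
        rintro _ ⟨p, hp, rfl⟩ _ ⟨q, hq, rfl⟩
        obtain ⟨r, hr, h₁, h₂⟩ := I.directed p hp q hq
        exact ⟨_, ⟨r, hr, rfl⟩, h₁.1, h₂.1⟩)
      (fun n => let ⟨p, hp, h⟩ := hlen n; ⟨_, ⟨p, hp, rfl⟩, h.1⟩)
    exact ⟨f, fun p hp => hf _ ⟨p, hp, rfl⟩⟩
  obtain ⟨g, hg⟩ : ∃ g : ℕ → ℕ, ∀ p ∈ I, p.right = initialSegment g p.right.length := by
    obtain ⟨f, hf⟩ := exists_common_extension (S := right '' (I : Set EnumerationPair))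
      (by
        rintro _ ⟨p, hp, rfl⟩ _ ⟨q, hq, rfl⟩
        obtain ⟨r, hr, h₁, h₂⟩ := I.directed p hp q hq
        exact ⟨_, ⟨r, hr, rfl⟩, h₁.2.1, h₂.2.1⟩)
      (fun n => let ⟨p, hp, h⟩ := hlen n; ⟨_, ⟨p, hp, rfl⟩, h.2⟩)
    exact ⟨f, fun p hp => hf _ ⟨p, hp, rfl⟩⟩
  have fmem : ∀ p ∈ I, ∀ a ∈ p.left, a ∈ Set.range f := fun p hp a ha => by
    rw [hf p hp] at ha
    obtain ⟨m, -, h⟩ := mem_initialSegment.1 ha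
    exact ⟨m, h⟩
  have gmem : ∀ p ∈ I, ∀ a ∈ p.right, a ∈ Set.range g := fun p hp a ha => by
    rw [hg p hp] at ha
    obtain ⟨m, -, h⟩ := mem_initialSegment.1 ha
    exact ⟨m, h⟩
  have favoid : ∀ p ∈ I, ∀ m, f m ∉ p.avoid := fun p hp m hm => by
    obtain ⟨q, hq, hl, -⟩ := hlen m
    obtain ⟨r, hr, h₁, h₂⟩ := I.directed p hp q hq
    refine r.left_notMem (f m) ?_ (h₁.2.2 hm)
    rw [hf r hr]
    exact mem_initialSegment.2 ⟨m, hl.trans_le h₂.1.length_le, rfl⟩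
  have gavoid : ∀ p ∈ I, ∀ m, g m ∉ p.avoid := fun p hp m hm => by
    obtain ⟨q, hq, -, hl⟩ := hlen m
    obtain ⟨r, hr, h₁, h₂⟩ := I.directed p hp q hq
    refine r.right_notMem (g m) ?_ (h₁.2.2 hm)
    rw [hg r hr]
    exact mem_initialSegment.2 ⟨m, hl.trans_le h₂.2.1.length_le, rfl⟩
  refine ⟨f, g, ?_, ?_, ?_⟩
  · ext a
    obtain ⟨p, hp, h | ⟨hl, hr⟩⟩ := hdec a
    · refine iff_of_false ?_ ?_
      · rintro ⟨m, rfl⟩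
        exact favoid p hp m h
      · rintro ⟨m, rfl⟩
        exact gavoid p hp m h
    · exact iff_of_true (fmem p hp a hl) (gmem p hp a hr)
  · intro h hh heq
    obtain ⟨c, hc⟩ := Nat.Partrec.Code.exists_code.1 (Partrec.nat_iff.1 hh.partrec)
    have hS : {y | ∃ x, y ∈ c.eval x} = Set.range f := by
      rw [← heq, hc]
      ext y
      simp [eq_comm]
    obtain ⟨p, hp, hI⟩ := meets (.inr (.inr (.inl c)))
    replace hp : (∃ a ∈ p.avoid, a ∈ {y | ∃ x, y ∈ c.eval x}) ∨
      ∃ a ∈ p.left, a ∉ {y | ∃ x, y ∈ c.eval x} := hp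
    rw [hS] at hp
    rcases hp with ⟨a, ha, m, rfl⟩ | ⟨a, ha, h⟩
    · exact favoid p hI m ha
    · exact h (fmem p hI a ha)
  · intro Z hZf hZg
    obtain ⟨ψ, hψ, mψ, eψ⟩ := exists_partrec_use hZf
    obtain ⟨χ, hχ, mχ, eχ⟩ := exists_partrec_use hZg
    obtain ⟨c, hc⟩ := exists_code_eval_encode hψ
    obtain ⟨d, hd⟩ := exists_code_eval_encode hχ
    obtain ⟨p, hp, hI⟩ := meets (.inr (.inr (.inr (c, d))))
    have hp : p.Splits c d ∨ ∀ q, p ≤ q → ¬ q.Splits c d := hp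
    rcases hp with ⟨x, y, z, hy, hz, hne⟩ | hns
    · refine absurd ?_ hne
      rw [hc, hf p hI] at hy
      rw [hd, hg p hI] at hz
      exact Part.mem_unique ((eψ _ _).2 ⟨_, hy⟩) ((eχ _ _).2 ⟨_, hz⟩)
    · -- every computation along a segment compatible with `p` gives the value of `Z`,
      -- since otherwise it splits from the computation of `Z` along `g`
      have sound : ∀ (ρ : List ℕ) x y, (∀ a ∈ ρ, a ∉ p.avoid) →
          y ∈ c.eval (Encodable.encode (p.left ++ ρ, x)) → y = Z x := by
        intro ρ x y hρ hy
        obtain ⟨n, hn⟩ := (eχ x (Z x)).1 (by simp)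
        by_contra hne
        have hle : p.right.length ≤ max n p.right.length := le_max_right _ _
        refine hns ⟨p.left ++ ρ, initialSegment g (max n p.right.length), p.avoid, ?_, ?_⟩
          ⟨⟨_, rfl⟩, ?_, subset_rfl⟩ ⟨x, y, Z x, hy, ?_, hne⟩
        · intro a ha
          exact (List.mem_append.1 ha).elim (p.left_notMem a) (hρ a)
        · intro a ha
          obtain ⟨m, -, rfl⟩ := mem_initialSegment.1 ha
          exact gavoid p hI m
        · show p.right <+: initialSegment g (max n p.right.length)
          rw [hg p hI, length_initialSegment]
          exact initialSegment_prefix g hle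
        · rw [hd]
          exact mχ _ _ _ _ (initialSegment_prefix g (le_max_left _ _)) hn
      have complete : ∀ x, ∃ ρ : List ℕ, (∀ a ∈ ρ, a ∉ p.avoid) ∧
          Z x ∈ c.eval (Encodable.encode (p.left ++ ρ, x)) := by
        intro x
        obtain ⟨n, hn⟩ := (eψ x (Z x)).1 (by simp)
        obtain ⟨ρ, hρ⟩ : p.left <+: initialSegment f (max n p.left.length) := by
          rw [hf p hI, length_initialSegment]
          exact initialSegment_prefix f (le_max_right _ _)
        refine ⟨ρ, fun a ha => ?_, ?_⟩
        · have : a ∈ initialSegment f (max n p.left.length) := hρ ▸ List.mem_append_right _ ha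
          obtain ⟨m, -, rfl⟩ := mem_initialSegment.1 this
          exact favoid p hI m
        · rw [hc, hρ]
          exact mψ _ _ _ _ (initialSegment_prefix f (le_max_left _ _)) hn
      have hfil : ∀ ρ : List ℕ, ∀ a ∈ ρ.filter (· ∉ p.avoid), a ∉ p.avoid := fun ρ a ha => by
        simpa using (List.mem_filter.1 ha).2
      -- search through all extensions of `p.left` which avoid `p.avoid`
      let G : ℕ → ℕ → Option ℕ := fun x m =>
        Nat.Partrec.Code.evaln m.unpair.2 c (Encodable.encode
          (p.left ++ (Denumerable.ofNat (List ℕ) m.unpair.1).filter (· ∉ p.avoid), x))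
      have hG : Computable₂ G := by
        have hav : PrimrecPred fun a : ℕ => a ∉ p.avoid :=
          ((Primrec.eq (α := ℕ)).exists_mem_list.comp (Primrec.const p.avoid.toList)
            Primrec.id).not.of_eq fun a => by simp
        have hm : Primrec fun q : ℕ × ℕ => q.2.unpair := Primrec.unpair.comp Primrec.snd
        exact (Nat.Partrec.Code.primrec_evaln.comp (((Primrec.snd.comp hm).pair
          (Primrec.const c)).pair (Primrec.encode.comp ((Primrec.list_append.comp
            (Primrec.const p.left) ((Primrec.listFilter hav).comp
              ((Primrec.ofNat (List ℕ)).comp (Primrec.fst.comp hm)))).pair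
                Primrec.fst)))).to_comp.to₂
      refine (Partrec.rfindOpt hG).of_eq_tot fun x => ?_
      obtain ⟨ρ, hρ, h⟩ := complete x
      obtain ⟨k, hk⟩ := Nat.Partrec.Code.evaln_complete.1 h
      have hdom : (Nat.rfindOpt (G x)).Dom := by
        refine Nat.rfindOpt_dom.2 ⟨Nat.pair (Encodable.encode ρ) k, Z x, ?_⟩
        have : ρ.filter (· ∉ p.avoid) = ρ := List.filter_eq_self.2 (by simpa using hρ)
        simp only [G, Nat.unpair_pair, Denumerable.ofNat_encode, this]
        exact hk
      obtain ⟨m, hm⟩ := Nat.rfindOpt_spec (Part.get_mem hdom)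
      have := sound _ _ _ (hfil _) (Nat.Partrec.Code.evaln_sound hm)
      exact this ▸ Part.get_mem hdom

/-! ### Course-of-values recursion -/

/-- Course-of-values recursion on natural numbers: the value at `c` is computed by `step` from the
list of the values at the members of `children c`, which have to be smaller than `c`. -/
def courseOfValues {α : Type*} (children : ℕ → List ℕ) (hlt : ∀ c, ∀ x ∈ children c, x < c)
    (step : α → ℕ × List ℕ → ℕ) (a : α) (c : ℕ) : ℕ :=
  step a (c, (children c).attach.map fun x => courseOfValues children hlt step a x.1)
termination_by c
decreasing_by exact hlt c x.1 x.2

theorem courseOfValues_eq {α : Type*} {children : ℕ → List ℕ}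
    (hlt : ∀ c, ∀ x ∈ children c, x < c) (step : α → ℕ × List ℕ → ℕ) (a : α) (c : ℕ) :
    courseOfValues children hlt step a c =
      step a (c, (children c).map (courseOfValues children hlt step a)) := by
  rw [courseOfValues]
  simp

theorem primrec_courseOfValues {α : Type*} [Primcodable α] {children : ℕ → List ℕ}
    (hc : Primrec children) (hlt : ∀ c, ∀ x ∈ children c, x < c) {step : α → ℕ × List ℕ → ℕ}
    (hs : Primrec₂ step) : Primrec₂ (courseOfValues children hlt step) :=
  Primrec.nat_omega_rec _ (m := fun _ c => c) (l := fun _ c => children c)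
    (g := fun a p => some (step a p)) Primrec.snd.to₂ (hc.comp Primrec.snd).to₂
    (Primrec.option_some.comp hs).to₂ (fun _ c => hlt c)
    (fun a c => congrArg some (courseOfValues_eq hlt step a c).symm)

theorem lt_encode_of_mem {a : ℕ} {l : List ℕ} (h : a ∈ l) : a < Encodable.encode l := by
  induction l with
  | nil => simp at h
  | cons b l ih =>
    rw [Encodable.encode_list_cons, Nat.lt_succ_iff]
    rcases List.mem_cons.1 h with rfl | h
    · exact Nat.left_le_pair _ _
    · exact (ih h).le.trans (Nat.right_le_pair _ _)

/-! ### Translation of Gödel numbers -/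

/-- The Gödel number of the constant symbol for `a`, as a term. -/
def constCode (a : ℕ) : ℕ := Nat.pair 1 (Nat.pair 0 (Nat.pair (Nat.pair 1 a) 0))

/-- The list of the Gödel numbers of the arguments of the function or relation symbol with which a
term or an atomic formula begins. -/
def argCodes (c : ℕ) : List ℕ := Denumerable.ofNat (List ℕ) c.unpair.2.unpair.2.unpair.2

theorem lt_of_mem_argCodes (c : ℕ) : ∀ x ∈ argCodes c, x < c := by
  intro x hx
  have := lt_encode_of_mem hx
  rw [argCodes, Denumerable.encode_ofNat] at this
  exact this.trans_le ((Nat.unpair_right_le _).trans ((Nat.unpair_right_le _).trans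
    (Nat.unpair_right_le _)))

/-- One step in the translation of the Gödel number of a closed term: `vals` are the translations
of the arguments, `fs` are the arities and numbers of the function symbols, and `T` is the table of
the translations of the constant symbols, where `b + 1` stands for the constant symbol for `b`. The
value `0` means that `c` is not the Gödel number of a closed term. -/
def termStep (fs : List (ℕ × ℕ)) (T : List ℕ) (p : ℕ × List ℕ) : ℕ :=
  if p.1.unpair.1 = 1 ∧ p.1.unpair.2.unpair.2.unpair.1.unpair.1 = 0 ∧
      (p.1.unpair.2.unpair.1, p.1.unpair.2.unpair.2.unpair.1.unpair.2) ∈ fs ∧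
      p.2.length = p.1.unpair.2.unpair.1 ∧ 0 ∉ p.2 then
    Nat.pair 1 (Nat.pair p.1.unpair.2.unpair.1
      (Nat.pair p.1.unpair.2.unpair.2.unpair.1 (Encodable.encode p.2)))
  else if p.1 = constCode p.1.unpair.2.unpair.2.unpair.1.unpair.2 ∧
      T[p.1.unpair.2.unpair.2.unpair.1.unpair.2]?.getD 0 ≠ 0 then
    constCode (T[p.1.unpair.2.unpair.2.unpair.1.unpair.2]?.getD 0 - 1)
  else 0

/-- The translation of the Gödel number of a closed term along a table of constants. -/
def termTransl (fs : List (ℕ × ℕ)) : List ℕ → ℕ → ℕ :=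
  courseOfValues argCodes lt_of_mem_argCodes (termStep fs)

theorem termTransl_eq (fs : List (ℕ × ℕ)) (T : List ℕ) (c : ℕ) :
    termTransl fs T c = termStep fs T (c, (argCodes c).map (termTransl fs T)) :=
  courseOfValues_eq _ _ _ _

/-- The Gödel numbers of the two sides of an implication. -/
def impCodes (c : ℕ) : List ℕ :=
  if c.unpair.1 = 3 then [c.unpair.2.unpair.1, c.unpair.2.unpair.2] else []

theorem lt_of_mem_impCodes (c : ℕ) : ∀ x ∈ impCodes c, x < c := by
  intro x hx
  unfold impCodes at hx
  split_ifs at hx with h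
  · have hc : c.unpair.2 < c := by
      conv_rhs => rw [← Nat.pair_unpair c, h]
      rw [Nat.pair]
      split_ifs <;> nlinarith
    rcases List.mem_pair.1 hx with rfl | rfl
    · exact (Nat.unpair_left_le _).trans_lt hc
    · exact (Nat.unpair_right_le _).trans_lt hc
  · simp at hx

/-- One step in the translation of the Gödel number of a quantifier-free sentence, where `vals`
are the translations of the two sides of an implication. The value `0` means that `c` is not the
Gödel number of a quantifier-free sentence, and `d + 1` that the translation is `d`. -/
def formulaStep (fs rs : List (ℕ × ℕ)) (T : List ℕ) (p : ℕ × List ℕ) : ℕ :=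
  if p.1 = 0 then 1
  else if p.1.unpair.1 = 1 then
    if termTransl fs T p.1.unpair.2.unpair.1 ≠ 0 ∧ termTransl fs T p.1.unpair.2.unpair.2 ≠ 0 then
      Nat.pair 1 (Nat.pair (termTransl fs T p.1.unpair.2.unpair.1)
        (termTransl fs T p.1.unpair.2.unpair.2)) + 1
    else 0
  else if p.1.unpair.1 = 2 then
    if (p.1.unpair.2.unpair.1, p.1.unpair.2.unpair.2.unpair.1) ∈ rs ∧
        (argCodes p.1).length = p.1.unpair.2.unpair.1 ∧
        0 ∉ (argCodes p.1).map (termTransl fs T) then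
      Nat.pair 2 (Nat.pair p.1.unpair.2.unpair.1 (Nat.pair p.1.unpair.2.unpair.2.unpair.1
        (Encodable.encode ((argCodes p.1).map (termTransl fs T))))) + 1
    else 0
  else if p.1.unpair.1 = 3 ∧ 0 ∉ p.2 then
    Nat.pair 3 (Nat.pair (p.2[0]?.getD 0 - 1) (p.2[1]?.getD 0 - 1)) + 1
  else 0

/-- The translation of the Gödel number of a quantifier-free sentence along a table of
constants; see `formulaStep` for the values. -/
def formulaTransl (fs rs : List (ℕ × ℕ)) : List ℕ → ℕ → ℕ :=
  courseOfValues impCodes lt_of_mem_impCodes (formulaStep fs rs)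

theorem formulaTransl_eq (fs rs : List (ℕ × ℕ)) (T : List ℕ) (c : ℕ) :
    formulaTransl fs rs T c =
      formulaStep fs rs T (c, (impCodes c).map (formulaTransl fs rs T)) :=
  courseOfValues_eq _ _ _ _

/-! ### The translation is primitive recursive -/

section Primrec

variable {α : Type*} [Primcodable α]

theorem _root_.Primrec.unpairFst {f : α → ℕ} (hf : Primrec f) : Primrec fun a => (f a).unpair.1 :=
  Primrec.fst.comp (Primrec.unpair.comp hf)

theorem _root_.Primrec.unpairSnd {f : α → ℕ} (hf : Primrec f) : Primrec fun a => (f a).unpair.2 :=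
  Primrec.snd.comp (Primrec.unpair.comp hf)

theorem _root_.PrimrecPred.mem_list {β : Type*} [Primcodable β] {f : α → List β} {g : α → β}
    (hf : Primrec f) (hg : Primrec g) : PrimrecPred fun a => g a ∈ f a := by
  have := ((Primrec.eq (α := β)).exists_mem_list.comp hf hg)
  exact this.of_eq fun a => by simp

theorem primrec_constCode {f : α → ℕ} (hf : Primrec f) : Primrec fun a => constCode (f a) :=
  Primrec₂.natPair.comp (.const _) (Primrec₂.natPair.comp (.const _)
    (Primrec₂.natPair.comp (Primrec₂.natPair.comp (.const _) hf) (.const _)))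

theorem primrec_argCodes : Primrec argCodes :=
  (Primrec.ofNat (List ℕ)).comp Primrec.id.unpairSnd.unpairSnd.unpairSnd

theorem primrec_termStep (fs : List (ℕ × ℕ)) : Primrec₂ (termStep fs) := by
  have hp : Primrec fun q : List ℕ × ℕ × List ℕ => q.2.1 := Primrec.fst.comp Primrec.snd
  have hv : Primrec fun q : List ℕ × ℕ × List ℕ => q.2.2 := Primrec.snd.comp Primrec.snd
  have hk := hp.unpairSnd.unpairSnd.unpairFst
  have hT : Primrec fun q : List ℕ × ℕ × List ℕ =>
      q.1[q.2.1.unpair.2.unpair.2.unpair.1.unpair.2]?.getD 0 :=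
    Primrec.option_getD.comp (Primrec.list_getElem?.comp Primrec.fst hk.unpairSnd) (.const 0)
  refine Primrec.ite (.and (Primrec.eq.comp hp.unpairFst (.const 1)) <|
    .and (Primrec.eq.comp hk.unpairFst (.const 0)) <|
    .and (PrimrecPred.mem_list (.const fs) (hp.unpairSnd.unpairFst.pair hk.unpairSnd)) <|
    .and (Primrec.eq.comp (Primrec.list_length.comp hv) hp.unpairSnd.unpairFst)
      (PrimrecPred.mem_list hv (.const 0)).not)
    (Primrec₂.natPair.comp (.const 1) <| Primrec₂.natPair.comp hp.unpairSnd.unpairFst <|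
      Primrec₂.natPair.comp hk (Primrec.encode.comp hv)) <|
    Primrec.ite (.and (Primrec.eq.comp hp (primrec_constCode hk.unpairSnd))
      (Primrec.eq.comp hT (.const 0)).not)
      (primrec_constCode (Primrec.nat_sub.comp hT (.const 1))) (.const 0)

theorem primrec_termTransl (fs : List (ℕ × ℕ)) : Primrec₂ (termTransl fs) :=
  primrec_courseOfValues primrec_argCodes _ (primrec_termStep fs)

theorem primrec_impCodes : Primrec impCodes :=
  Primrec.ite (Primrec.eq.comp Primrec.id.unpairFst (.const 3))
    (Primrec.list_cons.comp Primrec.id.unpairSnd.unpairFst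
      (Primrec.list_cons.comp Primrec.id.unpairSnd.unpairSnd (.const []))) (.const [])

theorem primrec_formulaStep (fs rs : List (ℕ × ℕ)) : Primrec₂ (formulaStep fs rs) := by
  have hp : Primrec fun q : List ℕ × ℕ × List ℕ => q.2.1 := Primrec.fst.comp Primrec.snd
  have hv : Primrec fun q : List ℕ × ℕ × List ℕ => q.2.2 := Primrec.snd.comp Primrec.snd
  have htm := primrec_termTransl fs
  have h₁ := htm.comp Primrec.fst hp.unpairSnd.unpairFst
  have h₂ := htm.comp Primrec.fst hp.unpairSnd.unpairSnd
  have ha := primrec_argCodes.comp hp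
  have hm : Primrec fun q : List ℕ × ℕ × List ℕ => (argCodes q.2.1).map (termTransl fs q.1) :=
    Primrec.list_map ha (htm.comp (Primrec.fst.comp Primrec.fst) Primrec.snd).to₂
  have hk := hp.unpairSnd.unpairSnd.unpairFst
  have hl := hp.unpairSnd.unpairFst
  have hget : ∀ i : ℕ, Primrec fun q : List ℕ × ℕ × List ℕ => q.2.2[i]?.getD 0 - 1 := fun i =>
    Primrec.nat_sub.comp (Primrec.option_getD.comp
      (Primrec.list_getElem?.comp hv (.const i)) (.const 0)) (.const 1)
  refine Primrec.ite (Primrec.eq.comp hp (.const 0)) (.const 1) <|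
    Primrec.ite (Primrec.eq.comp hp.unpairFst (.const 1)) (Primrec.ite
      (.and (Primrec.eq.comp h₁ (.const 0)).not (Primrec.eq.comp h₂ (.const 0)).not)
      (Primrec.succ.comp (Primrec₂.natPair.comp (.const 1) (Primrec₂.natPair.comp h₁ h₂)))
      (.const 0)) <|
    Primrec.ite (Primrec.eq.comp hp.unpairFst (.const 2)) (Primrec.ite
      (.and (PrimrecPred.mem_list (.const rs) (hl.pair hk)) <|
        .and (Primrec.eq.comp (Primrec.list_length.comp ha) hl)
        (PrimrecPred.mem_list hm (.const 0)).not)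
      (Primrec.succ.comp (Primrec₂.natPair.comp (.const 2) (Primrec₂.natPair.comp hl
        (Primrec₂.natPair.comp hk (Primrec.encode.comp hm)))))
      (.const 0)) <|
    Primrec.ite (.and (Primrec.eq.comp hp.unpairFst (.const 3))
      (PrimrecPred.mem_list hv (.const 0)).not)
      (Primrec.succ.comp (Primrec₂.natPair.comp (.const 3)
        (Primrec₂.natPair.comp (hget 0) (hget 1)))) (.const 0)

theorem primrec_formulaTransl (fs rs : List (ℕ × ℕ)) : Primrec₂ (formulaTransl fs rs) :=
  primrec_courseOfValues primrec_impCodes _ (primrec_formulaStep fs rs)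

end Primrec

/-! ### Gödel numbers determine terms and formulas -/

section Coding

variable {L : FirstOrder.Language.{u, v}}

theorem termCode_injective {α : Type w} {fc : ∀ l, L.Functions l → ℕ} {vc : α → ℕ}
    (hf : ∀ l, Function.Injective (fc l)) (hv : Function.Injective vc) :
    Function.Injective (termCode (L := L) fc vc) := by
  intro t
  induction t with
  | var a =>
    intro s h
    cases s with
    | var b =>
      simp only [termCode, Nat.pair_eq_pair, true_and] at h
      rw [hv h]
    | func g ss => simp [termCode, Nat.pair_eq_pair] at h
  | @func l f ts ih =>
    intro s h
    cases s with
    | var b => simp [termCode, Nat.pair_eq_pair] at h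
    | @func l' g ss =>
      simp only [termCode, Nat.pair_eq_pair, true_and] at h
      obtain ⟨rfl, hfg, hl⟩ := h
      have := List.ofFn_injective (Encodable.encode_injective hl)
      rw [hf l hfg, funext fun i => ih i (congrFun this i)]

theorem boundVarCode_injective {n : ℕ} : Function.Injective (boundVarCode (n := n)) := by
  rintro (a | a) (b | b) h
  · exact a.elim
  · exact a.elim
  · exact b.elim
  · exact congrArg Sum.inr (Fin.ext h)

theorem formulaCode_injective {fc : ∀ l, L.Functions l → ℕ} {rc : ∀ l, L.Relations l → ℕ}
    (hf : ∀ l, Function.Injective (fc l)) (hr : ∀ l, Function.Injective (rc l)) {n : ℕ} :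
    Function.Injective (formulaCode (L := L) fc rc (n := n)) := by
  intro φ
  have ht : ∀ n, Function.Injective (termCode (L := L) fc (boundVarCode (n := n))) := fun n =>
    termCode_injective hf boundVarCode_injective
  induction φ with
  | falsum => intro ψ h; cases ψ <;> simp [formulaCode, Nat.pair_eq_pair] at h ⊢
  | equal s t =>
    intro ψ h
    cases ψ with
    | equal s' t' =>
      simp only [formulaCode, Nat.pair_eq_pair, true_and] at h
      rw [ht _ h.1, ht _ h.2]
    | _ => simp [formulaCode, Nat.pair_eq_pair] at h
  | @rel n l R ts =>
    intro ψ h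
    cases ψ with
    | rel S ss =>
      simp only [formulaCode, Nat.pair_eq_pair, true_and] at h
      obtain ⟨rfl, hRS, hl⟩ := h
      have := List.ofFn_injective (Encodable.encode_injective hl)
      rw [hr l hRS, funext fun i => ht _ (congrFun this i)]
    | _ => simp [formulaCode, Nat.pair_eq_pair] at h
  | imp φ₁ φ₂ ih₁ ih₂ =>
    intro ψ h
    cases ψ with
    | imp ψ₁ ψ₂ =>
      simp only [formulaCode, Nat.pair_eq_pair, true_and] at h
      rw [ih₁ h.1, ih₂ h.2]
    | _ => simp [formulaCode, Nat.pair_eq_pair] at h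
  | all φ ih =>
    intro ψ h
    cases ψ with
    | all ψ =>
      simp only [formulaCode, Nat.pair_eq_pair, true_and] at h
      rw [ih h]
    | _ => simp [formulaCode, Nat.pair_eq_pair] at h

end Coding

namespace OmegaStructure

variable {L : FirstOrder.Language.{u, v}}

theorem constFunctionCode_injective [∀ n, Encodable (L.Functions n)] (D : Set ℕ) (l : ℕ) :
    Function.Injective (constFunctionCode (L := L) D l) := by
  intro f g h
  rcases l with _ | l
  · rcases f with f | a <;> rcases g with g | b <;>
      simp only [constFunctionCode, Nat.pair_eq_pair, true_and, zero_ne_one, one_ne_zero,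
        false_and] at h
    · rw [Encodable.encode_injective h]
    · exact congrArg Sum.inr (Subtype.ext h)
  · rcases f with f | a
    · rcases g with g | b
      · simp only [constFunctionCode, Nat.pair_eq_pair, true_and] at h
        rw [Encodable.encode_injective h]
      · exact PEmpty.elim b
    · exact PEmpty.elim a

theorem constRelationCode_injective [∀ n, Encodable (L.Relations n)] (D : Set ℕ) (l : ℕ) :
    Function.Injective (constRelationCode (L := L) D l) := by
  intro f g h
  rcases f with f | a
  · rcases g with g | b
    · rw [Encodable.encode_injective h]
    · exact Empty.elim b
  · exact Empty.elim a

/-- The Gödel number of a closed term of `L` expanded by constant symbols. -/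
abbrev closedTermCode [∀ n, Encodable (L.Functions n)] (D : Set ℕ) :
    (L[[D]]).Term (Empty ⊕ Fin 0) → ℕ :=
  termCode (constFunctionCode D) boundVarCode

/-- The constant symbol for an element, as a term. -/
def constTerm {D : Set ℕ} (a : D) : (L[[D]]).Term (Empty ⊕ Fin 0) :=
  .func (l := 0) (Sum.inr a) Fin.elim0

theorem closedTermCode_constTerm [∀ n, Encodable (L.Functions n)] {D : Set ℕ} (a : D) :
    closedTermCode (L := L) D (constTerm a) = constCode a := rfl

variable [∀ n, Encodable (L.Functions n)] [∀ n, Encodable (L.Relations n)]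

theorem sentenceCode_injective (D : Set ℕ) :
    Function.Injective (sentenceCode (L := L) D) :=
  formulaCode_injective (constFunctionCode_injective D) (constRelationCode_injective D)

theorem sentenceCode_mem_atomicDiagram {A : OmegaStructure L} {φ : (L[[A.dom]]).Sentence}
    (hφ : FirstOrder.Language.BoundedFormula.IsQF φ) :
    sentenceCode A.dom φ ∈ A.atomicDiagram ↔ A.dom ⊨ φ := by
  constructor
  · rintro ⟨ψ, -, hψ, h⟩
    rwa [← sentenceCode_injective _ h]
  · exact fun h => ⟨φ, hφ, h, rfl⟩

/-- The Gödel number of the sentence `a = a`. -/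
def selfEqCode (a : ℕ) : ℕ := Nat.pair 1 (Nat.pair (constCode a) (constCode a))

/-- The atomic diagram of a structure tells which numbers belong to the domain. -/
theorem selfEqCode_mem_atomicDiagram {A : OmegaStructure L} {a : ℕ} :
    selfEqCode a ∈ A.atomicDiagram ↔ a ∈ A.dom := by
  constructor
  · rintro ⟨φ, hφ, -, h⟩
    cases hφ with
    | falsum => simp [sentenceCode, formulaCode, selfEqCode, Nat.pair_eq_pair] at h
    | imp _ _ => simp [sentenceCode, formulaCode, selfEqCode, Nat.pair_eq_pair] at h
    | of_isAtomic hφ =>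
      cases hφ with
      | rel R ts =>
        simp [FirstOrder.Language.Relations.boundedFormula, sentenceCode, formulaCode, selfEqCode,
          Nat.pair_eq_pair] at h
      | equal s t =>
        simp only [sentenceCode, FirstOrder.Language.Term.bdEqual, formulaCode, selfEqCode,
          Nat.pair_eq_pair, true_and] at h
        replace h := h.1
        cases s with
        | var x => simp [termCode, constCode, Nat.pair_eq_pair] at h
        | @func l f ts =>
          simp only [termCode, constCode, Nat.pair_eq_pair, true_and] at h
          obtain ⟨rfl, h, -⟩ := h
          rcases f with f | b
          · simp [constFunctionCode, Nat.pair_eq_pair] at h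
          · simp only [constFunctionCode, Nat.pair_eq_pair, true_and] at h
            exact h ▸ Subtype.property (p := (· ∈ A.dom)) b
  · intro ha
    exact ⟨(constTerm ⟨a, ha⟩).bdEqual (constTerm ⟨a, ha⟩), .of_isAtomic (.equal _ _),
      by simp [FirstOrder.Language.Sentence.Realize, FirstOrder.Language.Formula.Realize], rfl⟩

end OmegaStructure

/-! ### Correctness of the translation -/

namespace OmegaStructure

open FirstOrder.Language

variable {L : FirstOrder.Language.{u, v}} [∀ n, Encodable (L.Functions n)]

theorem argCodes_pair (a l k : ℕ) (s : List ℕ) :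
    argCodes (Nat.pair a (Nat.pair l (Nat.pair k (Encodable.encode s)))) = s := by
  simp [argCodes]

theorem closedTermCode_ne_zero {D : Set ℕ} (t : (L[[D]]).Term (Empty ⊕ Fin 0)) :
    closedTermCode D t ≠ 0 := by
  cases t with
  | var x => exact x.elim Empty.elim Fin.elim0
  | func f ts => simp [closedTermCode, termCode, Nat.pair]; split_ifs <;> simp

/-- `tab` is the table of the values of `e`: a number outside the domain of `B` has the value `0`,
and an element `a` of `B` has the value `e a + 1`. -/
structure IsTable {A B : OmegaStructure L} (e : B.dom ≃[L] A.dom) (tab : ℕ → ℕ) : Prop where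
  apply_mem (a : B.dom) : tab a = e a + 1
  apply_notMem (a : ℕ) : a ∉ B.dom → tab a = 0

variable {A B : OmegaStructure L} {e : B.dom ≃[L] A.dom} {tab : ℕ → ℕ} {fs : List (ℕ × ℕ)}

/-- Translating the Gödel number of a closed term gives the Gödel number of a closed term with the
corresponding value. -/
theorem exists_termTransl_closedTermCode (htab : IsTable e tab)
    (hfs : ∀ l k, (l, k) ∈ fs ↔ ∃ f : L.Functions l, Encodable.encode f = k)
    {n : ℕ} (t : (L[[B.dom]]).Term (Empty ⊕ Fin 0)) (hn : closedTermCode B.dom t < n) :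
    ∃ t' : (L[[A.dom]]).Term (Empty ⊕ Fin 0),
      termTransl fs (initialSegment tab n) (closedTermCode B.dom t) = closedTermCode A.dom t' ∧
      ∀ (x : Empty ⊕ Fin 0 → B.dom) (y : Empty ⊕ Fin 0 → A.dom),
        t'.realize y = e (t.realize x) := by
  induction t with
  | var x => exact x.elim Empty.elim Fin.elim0
  | @func l f ts ih =>
    have hargs : argCodes (closedTermCode B.dom (.func f ts)) =
        List.ofFn fun i => closedTermCode B.dom (ts i) := argCodes_pair _ _ _ _
    have hlt : ∀ i, closedTermCode B.dom (ts i) < n := fun i =>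
      (lt_of_mem_argCodes _ _ (by rw [hargs, List.mem_ofFn]; exact ⟨i, rfl⟩)).trans hn
    rcases f with f | a
    · choose ts' hts' hval using fun i => ih i (hlt i)
      refine ⟨.func (Sum.inl f) ts', ?_, fun x y => ?_⟩
      · have hmap : (argCodes (closedTermCode B.dom (.func (Sum.inl f) ts))).map
            (termTransl fs (initialSegment tab n)) =
              List.ofFn fun i => closedTermCode A.dom (ts' i) := by
          rw [hargs, List.map_ofFn]
          exact congrArg List.ofFn (funext hts')
        rw [termTransl_eq, hmap]
        have hk : ∀ D : Set ℕ, constFunctionCode (L := L) D l (Sum.inl f) =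
            Nat.pair 0 (Encodable.encode f) := fun D => by cases l <;> rfl
        have h0 : 0 ∉ List.ofFn fun i => closedTermCode A.dom (ts' i) := by
          rw [List.mem_ofFn]
          rintro ⟨i, hi⟩
          exact closedTermCode_ne_zero _ hi
        simp only [termStep, closedTermCode, termCode, hk, Nat.unpair_pair]
        exact if_pos ⟨trivial, trivial, (hfs _ _).2 ⟨f, rfl⟩, by simp, h0⟩
      · change Structure.funMap f (fun i => (ts' i).realize y) =
          e (Structure.funMap f fun i => (ts i).realize x)
        rw [e.map_fun]
        exact congrArg _ (funext fun i => hval i x y)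
    · rcases l with _ | l
      · refine ⟨constTerm (e a), ?_, fun x y => rfl⟩
        have hcode : closedTermCode (L := L) B.dom (.func (l := 0) (Sum.inr a) ts) =
            constCode (Subtype.val (p := (· ∈ B.dom)) a) := by
          rw [Subsingleton.elim ts Fin.elim0]
          rfl
        have ha : Subtype.val (p := (· ∈ B.dom)) a < n := by
          refine lt_of_le_of_lt ?_ (hcode ▸ hn)
          exact (Nat.right_le_pair _ _).trans ((Nat.left_le_pair _ _).trans
            ((Nat.right_le_pair _ _).trans (Nat.right_le_pair _ _)))
        have htab' := htab.apply_mem a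
        rw [hcode, termTransl_eq, closedTermCode_constTerm]
        have hget : (initialSegment tab n)[Subtype.val (p := (· ∈ B.dom)) a]? =
            some ((e a : ℕ) + 1) := by
          rw [getElem?_initialSegment, if_pos ha, htab']
        simp [termStep, constCode, hget]
      · exact PEmpty.elim a

/-- A number whose translation does not fail is the Gödel number of a closed term. -/
theorem exists_closedTermCode_eq (htab : IsTable e tab)
    (hfs : ∀ l k, (l, k) ∈ fs ↔ ∃ f : L.Functions l, Encodable.encode f = k)
    {n : ℕ} (c : ℕ) (hc : termTransl fs (initialSegment tab n) c ≠ 0) :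
    ∃ t : (L[[B.dom]]).Term (Empty ⊕ Fin 0), closedTermCode B.dom t = c := by
  induction c using Nat.strong_induction_on with
  | _ c ih =>
    rw [termTransl_eq, termStep] at hc
    simp only at hc
    split_ifs at hc with h₁ h₂
    · obtain ⟨h1, h0, hf, hlen, hnz⟩ := h₁
      obtain ⟨f, hf⟩ := (hfs _ _).1 hf
      rw [List.length_map] at hlen
      have hex : ∀ i : Fin (argCodes c).length, ∃ t : (L[[B.dom]]).Term (Empty ⊕ Fin 0),
          closedTermCode B.dom t = (argCodes c)[i] := fun i =>
        ih _ (lt_of_mem_argCodes _ _ (List.getElem_mem _)) fun h =>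
          hnz (List.mem_map.2 ⟨_, List.getElem_mem _, h⟩)
      choose ts hts using hex
      refine ⟨.func (Sum.inl f) fun i => ts (Fin.cast hlen.symm i), ?_⟩
      have hk : ∀ l (f : L.Functions l), constFunctionCode B.dom l (Sum.inl f) =
          Nat.pair 0 (Encodable.encode f) := fun l f => by cases l <;> rfl
      have hofFn : (List.ofFn fun i => closedTermCode B.dom (ts (Fin.cast hlen.symm i))) =
          argCodes c := by
        refine List.ext_getElem (by simp [hlen]) fun i h h' => ?_
        simp [hts]
      have hnum : Nat.pair 0 (Encodable.encode f) = c.unpair.2.unpair.2.unpair.1 := by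
        rw [hf, ← h0, Nat.pair_unpair]
      simp only [closedTermCode, termCode, hk]
      rw [hofFn, hnum, argCodes, Denumerable.encode_ofNat, Nat.pair_unpair, Nat.pair_unpair, ← h1,
        Nat.pair_unpair]
    · obtain ⟨h, hb⟩ := h₂
      have ha : c.unpair.2.unpair.2.unpair.1.unpair.2 ∈ B.dom := by
        by_contra hmem
        refine hb ?_
        rw [getElem?_initialSegment]
        split_ifs
        · exact htab.apply_notMem _ hmem
        · rfl
      exact ⟨constTerm ⟨_, ha⟩, h.symm⟩
    · exact absurd rfl hc

variable [∀ n, Encodable (L.Relations n)] {rs : List (ℕ × ℕ)}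

/-- Translating the Gödel number of a quantifier-free sentence gives the Gödel number of a
quantifier-free sentence with the same truth value. -/
theorem exists_formulaTransl_sentenceCode (htab : IsTable e tab)
    (hfs : ∀ l k, (l, k) ∈ fs ↔ ∃ f : L.Functions l, Encodable.encode f = k)
    (hrs : ∀ l k, (l, k) ∈ rs ↔ ∃ R : L.Relations l, Encodable.encode R = k)
    {n : ℕ} {φ : (L[[B.dom]]).Sentence} (hφ : BoundedFormula.IsQF φ)
    (hn : sentenceCode B.dom φ < n) :
    ∃ ψ : (L[[A.dom]]).Sentence, BoundedFormula.IsQF ψ ∧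
      formulaTransl fs rs (initialSegment tab n) (sentenceCode B.dom φ) =
        sentenceCode A.dom ψ + 1 ∧ (A.dom ⊨ ψ ↔ B.dom ⊨ φ) := by
  induction hφ with
  | falsum =>
    refine ⟨.falsum, .falsum, ?_, Iff.rfl⟩
    rw [formulaTransl_eq]
    rfl
  | of_isAtomic hφ =>
    cases hφ with
    | equal s t =>
      have hcode : sentenceCode B.dom (s.bdEqual t) =
        Nat.pair 1 (Nat.pair (closedTermCode B.dom s) (closedTermCode B.dom t)) := rfl
      have hle : Nat.pair (closedTermCode B.dom s) (closedTermCode B.dom t) < n :=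
        (Nat.right_le_pair _ _).trans_lt (hcode ▸ hn)
      obtain ⟨s', hs, hs'⟩ := exists_termTransl_closedTermCode htab hfs s
        ((Nat.left_le_pair _ _).trans_lt hle)
      obtain ⟨t', ht, ht'⟩ := exists_termTransl_closedTermCode htab hfs t
        ((Nat.right_le_pair _ _).trans_lt hle)
      refine ⟨s'.bdEqual t', .of_isAtomic (.equal _ _), ?_, ?_⟩
      · have hcode' : sentenceCode A.dom (s'.bdEqual t') =
          Nat.pair 1 (Nat.pair (closedTermCode A.dom s') (closedTermCode A.dom t')) := rfl
        have h0 : ∀ m, Nat.pair 1 m ≠ 0 := fun m => by rw [Nat.pair]; split_ifs <;> simp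
        rw [formulaTransl_eq, hcode, hcode', formulaStep]
        simp only [Nat.unpair_pair, hs, ht, if_neg (h0 _), if_true]
        exact if_pos ⟨closedTermCode_ne_zero _, closedTermCode_ne_zero _⟩
      · simp only [FirstOrder.Language.Sentence.Realize, FirstOrder.Language.Formula.Realize,
          BoundedFormula.realize_bdEqual]
        rw [hs' (Sum.elim default default), ht' (Sum.elim default default), e.injective.eq_iff]
    | @rel l R ts =>
      rcases R with R | R
      swap
      · exact Empty.elim R
      have hcode : sentenceCode B.dom (Relations.boundedFormula (Sum.inl R) ts) =
        Nat.pair 2 (Nat.pair l (Nat.pair (Encodable.encode R)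
          (Encodable.encode (List.ofFn fun i => closedTermCode B.dom (ts i))))) := rfl
      have hargs : argCodes (sentenceCode B.dom (Relations.boundedFormula (Sum.inl R) ts)) =
          List.ofFn fun i => closedTermCode B.dom (ts i) := argCodes_pair _ _ _ _
      have hlt : ∀ i, closedTermCode B.dom (ts i) < n := fun i =>
        (lt_of_mem_argCodes _ _ (by rw [hargs, List.mem_ofFn]; exact ⟨i, rfl⟩)).trans hn
      choose ts' hts' hval using fun i => exists_termTransl_closedTermCode htab hfs _ (hlt i)
      have hmap : (argCodes (sentenceCode B.dom (Relations.boundedFormula (Sum.inl R) ts))).map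
          (termTransl fs (initialSegment tab n)) =
            List.ofFn fun i => closedTermCode A.dom (ts' i) := by
        rw [hargs, List.map_ofFn]
        exact congrArg List.ofFn (funext hts')
      have h0 : 0 ∉ List.ofFn fun i => closedTermCode A.dom (ts' i) := by
        rw [List.mem_ofFn]
        rintro ⟨i, hi⟩
        exact closedTermCode_ne_zero _ hi
      refine ⟨Relations.boundedFormula (Sum.inl R) ts', .of_isAtomic (.rel _ _), ?_, ?_⟩
      · have hcode' : sentenceCode A.dom (Relations.boundedFormula (Sum.inl R) ts') =
          Nat.pair 2 (Nat.pair l (Nat.pair (Encodable.encode R)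
            (Encodable.encode (List.ofFn fun i => closedTermCode A.dom (ts' i))))) := rfl
        have hne : ∀ m, Nat.pair 2 m ≠ 0 := fun m => by rw [Nat.pair]; split_ifs <;> simp
        rw [formulaTransl_eq, formulaStep]
        simp only [hmap]
        rw [hargs, hcode, hcode']
        simp only [Nat.unpair_pair, if_neg (hne _), if_true, OfNat.ofNat_ne_one, if_false]
        exact if_pos ⟨(hrs _ _).2 ⟨R, rfl⟩, by simp, h0⟩
      · change Structure.RelMap R (fun i => (ts' i).realize (Sum.elim default default)) ↔
          Structure.RelMap R fun i => (ts i).realize (Sum.elim default default)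
        rw [← e.map_rel]
        exact iff_of_eq (congrArg _ (funext fun i => hval i _ _))
  | @imp φ₁ φ₂ _ _ ih₁ ih₂ =>
    have hcode : sentenceCode B.dom (φ₁.imp φ₂) =
      Nat.pair 3 (Nat.pair (sentenceCode B.dom φ₁) (sentenceCode B.dom φ₂)) := rfl
    have hle : Nat.pair (sentenceCode B.dom φ₁) (sentenceCode B.dom φ₂) < n :=
      (Nat.right_le_pair _ _).trans_lt (hcode ▸ hn)
    obtain ⟨ψ₁, q₁, h₁, i₁⟩ := ih₁ ((Nat.left_le_pair _ _).trans_lt hle)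
    obtain ⟨ψ₂, q₂, h₂, i₂⟩ := ih₂ ((Nat.right_le_pair _ _).trans_lt hle)
    refine ⟨ψ₁.imp ψ₂, q₁.imp q₂, ?_, ?_⟩
    · have hcode' : sentenceCode A.dom (ψ₁.imp ψ₂) =
        Nat.pair 3 (Nat.pair (sentenceCode A.dom ψ₁) (sentenceCode A.dom ψ₂)) := rfl
      have hne : ∀ m, Nat.pair 3 m ≠ 0 := fun m => by rw [Nat.pair]; split_ifs <;> simp
      rw [formulaTransl_eq, hcode, hcode', formulaStep]
      simp [impCodes, h₁, h₂, hne]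
    · exact imp_congr i₁ i₂

/-- A number whose translation does not fail is the Gödel number of a quantifier-free sentence. -/
theorem exists_sentenceCode_eq (htab : IsTable e tab)
    (hfs : ∀ l k, (l, k) ∈ fs ↔ ∃ f : L.Functions l, Encodable.encode f = k)
    (hrs : ∀ l k, (l, k) ∈ rs ↔ ∃ R : L.Relations l, Encodable.encode R = k)
    {n : ℕ} (c : ℕ) (hc : formulaTransl fs rs (initialSegment tab n) c ≠ 0) :
    ∃ φ : (L[[B.dom]]).Sentence, BoundedFormula.IsQF φ ∧ sentenceCode B.dom φ = c := by
  induction c using Nat.strong_induction_on with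
  | _ c ih =>
    rw [formulaTransl_eq, formulaStep] at hc
    simp only at hc
    split_ifs at hc with h₀ h₁ h₁' h₂ h₂' h₃
    · exact ⟨.falsum, .falsum, h₀.symm⟩
    · obtain ⟨s, hs⟩ := exists_closedTermCode_eq htab hfs _ h₁'.1
      obtain ⟨t, ht⟩ := exists_closedTermCode_eq htab hfs _ h₁'.2
      refine ⟨s.bdEqual t, .of_isAtomic (.equal _ _), ?_⟩
      change Nat.pair 1 (Nat.pair (closedTermCode B.dom s) (closedTermCode B.dom t)) = c
      rw [hs, ht, Nat.pair_unpair, ← h₁, Nat.pair_unpair]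
    · exact absurd rfl hc
    · obtain ⟨hR, hlen, hnz⟩ := h₂'
      obtain ⟨R, hR⟩ := (hrs _ _).1 hR
      have hex : ∀ i : Fin (argCodes c).length, ∃ t : (L[[B.dom]]).Term (Empty ⊕ Fin 0),
          closedTermCode B.dom t = (argCodes c)[i] := fun i =>
        exists_closedTermCode_eq htab hfs (n := n) _ fun h =>
          hnz (List.mem_map.2 ⟨_, List.getElem_mem _, h⟩)
      choose ts hts using hex
      refine ⟨Relations.boundedFormula (Sum.inl R) fun i => ts (Fin.cast hlen.symm i),
        .of_isAtomic (.rel _ _), ?_⟩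
      have hofFn : (List.ofFn fun i => closedTermCode B.dom (ts (Fin.cast hlen.symm i))) =
          argCodes c := by
        refine List.ext_getElem (by simp [hlen]) fun i h h' => ?_
        simp [hts]
      change Nat.pair 2 (Nat.pair _ (Nat.pair (Encodable.encode R)
        (Encodable.encode
          (List.ofFn fun i => closedTermCode B.dom (ts (Fin.cast hlen.symm i)))))) = c
      rw [hofFn, hR, argCodes, Denumerable.encode_ofNat, Nat.pair_unpair, Nat.pair_unpair, ← h₂,
        Nat.pair_unpair]
    · exact absurd rfl hc
    · obtain ⟨h₃, hnz⟩ := h₃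
      simp only [impCodes, if_pos h₃, List.map_cons, List.map_nil, List.mem_cons, List.not_mem_nil,
        or_false, not_or] at hnz
      have hmem : c.unpair.2.unpair.1 ∈ impCodes c ∧ c.unpair.2.unpair.2 ∈ impCodes c := by
        simp [impCodes, h₃]
      obtain ⟨φ, q, hφ⟩ := ih _ (lt_of_mem_impCodes _ _ hmem.1) (Ne.symm hnz.1)
      obtain ⟨ψ, q', hψ⟩ := ih _ (lt_of_mem_impCodes _ _ hmem.2) (Ne.symm hnz.2)
      refine ⟨φ.imp ψ, q.imp q', ?_⟩
      change Nat.pair 3 (Nat.pair (sentenceCode B.dom φ) (sentenceCode B.dom ψ)) = c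
      rw [hφ, hψ, Nat.pair_unpair, ← h₃, Nat.pair_unpair]
    · exact absurd rfl hc

end OmegaStructure

/-! ### Copies computable from an enumeration of the atomic diagram -/

/-- The element `b` of the domain for which `y` is the Gödel number of `b = b`, in the form
`b + 1`; the value is `0` if there is none. -/
def domValue (y : ℕ) : ℕ :=
  if y = OmegaStructure.selfEqCode y.unpair.2.unpair.1.unpair.2.unpair.2.unpair.1.unpair.2 then
    y.unpair.2.unpair.1.unpair.2.unpair.2.unpair.1.unpair.2 + 1
  else 0

theorem domValue_eq_succ {y b : ℕ} :
    domValue y = b + 1 ↔ y = OmegaStructure.selfEqCode b := by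
  unfold domValue
  constructor
  · intro h
    split_ifs at h with h'
    rwa [Nat.succ_injective h] at h'
  · rintro rfl
    simp [OmegaStructure.selfEqCode, constCode]

theorem primrec_domValue : Primrec domValue := by
  have hb := (Primrec.id (α := ℕ)).unpairSnd.unpairFst.unpairSnd.unpairSnd.unpairFst.unpairSnd
  have hc := primrec_constCode hb
  exact Primrec.ite (Primrec.eq.comp .id (Primrec₂.natPair.comp (.const 1)
    (Primrec₂.natPair.comp hc hc))) (Primrec.succ.comp hb) (.const 0)

/-- From an enumeration `h` of an atomic diagram, the table of a bijection from a set of natural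
numbers to the domain: an element is the image of the least `a` such that `h a` tells that it
belongs to the domain. -/
def domTable (h : ℕ → ℕ) (a : ℕ) : ℕ :=
  if domValue (h a) ∈ initialSegment (fun i => domValue (h i)) a then 0 else domValue (h a)

theorem domTable_injOn {h : ℕ → ℕ} {a b : ℕ} (ha : domTable h a ≠ 0)
    (hab : domTable h a = domTable h b) : a = b := by
  have hb := hab ▸ ha
  unfold domTable at ha hb hab
  split_ifs at ha hb hab with h₁ h₂ h₂ <;> try exact absurd rfl ‹0 ≠ 0›
  rw [mem_initialSegment] at h₁ h₂
  rcases lt_trichotomy a b with hlt | rfl | hlt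
  · exact absurd ⟨a, hlt, hab⟩ h₂
  · rfl
  · exact absurd ⟨b, hlt, hab.symm⟩ h₁

theorem exists_domTable_eq_succ {h : ℕ → ℕ} {b : ℕ} :
    (∃ a, domTable h a = b + 1) ↔ OmegaStructure.selfEqCode b ∈ Set.range h := by
  classical
  constructor
  · rintro ⟨a, ha⟩
    unfold domTable at ha
    split_ifs at ha
    exact ⟨a, domValue_eq_succ.1 ha⟩
  · intro hb
    have hb : ∃ a, h a = OmegaStructure.selfEqCode b := hb
    refine ⟨Nat.find hb, ?_⟩
    have hv := domValue_eq_succ.2 (Nat.find_spec hb)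
    rw [domTable, if_neg, hv]
    rw [mem_initialSegment]
    rintro ⟨m, hm, h'⟩
    exact Nat.find_min hb hm (domValue_eq_succ.1 (h'.trans hv))

/-- The initial segments of `domTable h`, computed from those of `h`. -/
def domTableSegment (σ : List ℕ) : List ℕ :=
  (List.range σ.length).map fun a =>
    if (σ.map domValue)[a]?.getD 0 ∈ (σ.map domValue).take a then 0
    else (σ.map domValue)[a]?.getD 0

theorem domTableSegment_initialSegment (h : ℕ → ℕ) (n : ℕ) :
    domTableSegment (initialSegment h n) = initialSegment (domTable h) n := by
  unfold domTableSegment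
  rw [length_initialSegment, initialSegment.eq_1 (domTable h)]
  refine List.map_congr_left fun a ha => ?_
  have ha := List.mem_range.1 ha
  have hmap : (initialSegment h n).map domValue = initialSegment (fun i => domValue (h i)) n := by
    simp [initialSegment]
  rw [hmap, take_initialSegment _ ha.le, getElem?_initialSegment, if_pos ha]
  rfl

theorem primrec_domTableSegment : Primrec domTableSegment := by
  have hm : Primrec fun q : List ℕ × ℕ => q.1.map domValue :=
    Primrec.list_map Primrec.fst (primrec_domValue.comp Primrec.snd).to₂
  have hg : Primrec fun q : List ℕ × ℕ => (q.1.map domValue)[q.2]?.getD 0 :=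
    Primrec.option_getD.comp (Primrec.list_getElem?.comp hm Primrec.snd) (.const 0)
  exact Primrec.list_map (Primrec.list_range.comp Primrec.list_length)
    (Primrec.ite (PrimrecPred.mem_list (Primrec.list_take.comp Primrec.snd hm) hg)
      (.const 0) hg).to₂

namespace OmegaStructure

open FirstOrder.Language

variable {L : FirstOrder.Language.{u, v}} [∀ n, Encodable (L.Functions n)]
  [∀ n, Encodable (L.Relations n)]

/-- The bijection with table `domTable h` carries the structure of `A` over to a copy. -/
theorem exists_copy_isTable {A : OmegaStructure L} {h : ℕ → ℕ}
    (hh : IsEnumeration h A.atomicDiagram) :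
    ∃ (B : OmegaStructure L) (e : B.dom ≃[L] A.dom), IsTable e (domTable h) := by
  have hdom : ∀ b, b ∈ A.dom ↔ ∃ a, domTable h a = b + 1 := fun b => by
    rw [exists_domTable_eq_succ, hh, selfEqCode_mem_atomicDiagram]
  let f : {a | domTable h a ≠ 0} → A.dom := fun a =>
    ⟨domTable h a - 1, (hdom _).2 ⟨a, (Nat.succ_pred_eq_of_ne_zero a.2).symm⟩⟩
  have hf : ∀ a : {a | domTable h a ≠ 0}, domTable h a = f a + 1 := fun a =>
    (Nat.succ_pred_eq_of_ne_zero a.2).symm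
  have hbij : Function.Bijective f := by
    constructor
    · intro a b hab
      exact Subtype.ext (domTable_injOn a.2 (by rw [hf a, hf b, hab]))
    · intro b
      obtain ⟨a, ha⟩ := (hdom b).1 b.2
      refine ⟨⟨a, by simp [ha]⟩, Subtype.ext ?_⟩
      simp [f, ha]
  let e := (Equiv.ofBijective f hbij).symm
  let str : L.Structure {a | domTable h a ≠ 0} := e.inducedStructure
  let i : A.dom ≃[L] {a | domTable h a ≠ 0} := e.inducedStructureEquiv
  exact ⟨⟨{a | domTable h a ≠ 0}, str⟩, i.symm,
    fun a => hf a, fun a ha => not_not.1 ha⟩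

theorem exists_functionSymbols (L : FirstOrder.Language.{u, v}) [Finite L.Symbols]
    [∀ n, Encodable (L.Functions n)] : ∃ fs : List (ℕ × ℕ),
      ∀ l k, (l, k) ∈ fs ↔ ∃ f : L.Functions l, Encodable.encode f = k := by
  have : Finite (Σ l, L.Functions l) :=
    Finite.of_injective (Sum.inl : _ → L.Symbols) Sum.inl_injective
  obtain ⟨s, hs⟩ := (Set.finite_range fun p : Σ l, L.Functions l =>
    (p.1, Encodable.encode p.2)).exists_finset
  refine ⟨s.toList, fun l k => ?_⟩
  rw [Finset.mem_toList, hs]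
  constructor
  · rintro ⟨⟨l', f⟩, h⟩
    obtain ⟨rfl, rfl⟩ := Prod.mk.inj h
    exact ⟨f, rfl⟩
  · rintro ⟨f, rfl⟩
    exact ⟨⟨l, f⟩, rfl⟩

theorem exists_relationSymbols (L : FirstOrder.Language.{u, v}) [Finite L.Symbols]
    [∀ n, Encodable (L.Relations n)] : ∃ rs : List (ℕ × ℕ),
      ∀ l k, (l, k) ∈ rs ↔ ∃ R : L.Relations l, Encodable.encode R = k := by
  have : Finite (Σ l, L.Relations l) :=
    Finite.of_injective (Sum.inr : _ → L.Symbols) Sum.inr_injective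
  obtain ⟨s, hs⟩ := (Set.finite_range fun p : Σ l, L.Relations l =>
    (p.1, Encodable.encode p.2)).exists_finset
  refine ⟨s.toList, fun l k => ?_⟩
  rw [Finset.mem_toList, hs]
  constructor
  · rintro ⟨⟨l', f⟩, h⟩
    obtain ⟨rfl, rfl⟩ := Prod.mk.inj h
    exact ⟨f, rfl⟩
  · rintro ⟨f, rfl⟩
    exact ⟨⟨l, f⟩, rfl⟩

/-- An enumeration of the atomic diagram of a structure computes a copy of the structure. -/
theorem exists_copy_turingReducible [Finite L.Symbols] {A : OmegaStructure L} {h : ℕ → ℕ}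
    (hh : IsEnumeration h A.atomicDiagram) :
    ∃ B : OmegaStructure L, Nonempty (B.dom ≃[L] A.dom) ∧
      (charFun B.atomicDiagram : ℕ →. ℕ) ≤ᵀ (h : ℕ →. ℕ) := by
  obtain ⟨B, e, htab⟩ := exists_copy_isTable hh
  obtain ⟨fs, hfs⟩ := exists_functionSymbols L
  obtain ⟨rs, hrs⟩ := exists_relationSymbols L
  refine ⟨B, ⟨e⟩, ?_⟩
  let F : List ℕ → ℕ → ℕ := fun σ c => formulaTransl fs rs (domTableSegment (σ.take (c + 1))) c
  let G : List ℕ → ℕ → Option ℕ := fun σ c =>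
    if σ.length ≤ c then none
    else if F σ c = 0 then some 0
    else if F σ c - 1 ∈ σ then some 1
    else if Nat.pair 3 (Nat.pair (F σ c - 1) 0) ∈ σ then some 0
    else none
  have hG : Computable₂ G := by
    have hF : Primrec fun q : List ℕ × ℕ => F q.1 q.2 :=
      (primrec_formulaTransl fs rs).comp (primrec_domTableSegment.comp
        (Primrec.list_take.comp (Primrec.succ.comp Primrec.snd) Primrec.fst)) Primrec.snd
    have hF' := Primrec.nat_sub.comp hF (Primrec.const 1)
    exact (Primrec.ite (Primrec.nat_le.comp (Primrec.list_length.comp Primrec.fst) Primrec.snd)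
      (.const none) <| Primrec.ite (Primrec.eq.comp hF (.const 0)) (.const (some 0)) <|
      Primrec.ite (PrimrecPred.mem_list Primrec.fst hF') (.const (some 1)) <|
      Primrec.ite (PrimrecPred.mem_list Primrec.fst (Primrec₂.natPair.comp (.const 3)
        (Primrec₂.natPair.comp hF' (.const 0)))) (.const (some 0)) (.const none)).to_comp.to₂
  -- the translation of `c`, which needs only the constants up to `c`, since the Gödel number of
  -- a sentence is larger than the constants which occur in it
  let T : ℕ → ℕ := fun c => formulaTransl fs rs (initialSegment (domTable h) (c + 1)) c
  have hFT : ∀ n c, c < n → F (initialSegment h n) c = T c := fun n c hc => by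
    simp only [F, T, ← domTableSegment_initialSegment, take_initialSegment h hc]
  -- what the translation tells about the truth of a sentence
  have hzero : ∀ c, T c = 0 → c ∉ B.atomicDiagram := by
    rintro _ h0 ⟨φ, hφ, -, rfl⟩
    obtain ⟨ψ, -, hψ, -⟩ := exists_formulaTransl_sentenceCode htab hfs hrs hφ (Nat.lt_succ_self _)
    exact Nat.succ_ne_zero _ (hψ.symm.trans h0)
  have hpos : ∀ c, T c ≠ 0 → (c ∈ B.atomicDiagram ↔ T c - 1 ∈ A.atomicDiagram) ∧
      (c ∉ B.atomicDiagram ↔ Nat.pair 3 (Nat.pair (T c - 1) 0) ∈ A.atomicDiagram) := by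
    intro c h0
    obtain ⟨φ, hφ, rfl⟩ := exists_sentenceCode_eq htab hfs hrs c h0
    obtain ⟨ψ, qψ, hψ, hiff⟩ :=
      exists_formulaTransl_sentenceCode htab hfs hrs hφ (Nat.lt_succ_self _)
    have hnot : Nat.pair 3 (Nat.pair (sentenceCode A.dom ψ) 0) =
      sentenceCode A.dom (ψ.imp .falsum) := rfl
    have hT : T (sentenceCode B.dom φ) = sentenceCode A.dom ψ + 1 := hψ
    rw [hT, Nat.add_sub_cancel, hnot, sentenceCode_mem_atomicDiagram hφ,
      sentenceCode_mem_atomicDiagram qψ, sentenceCode_mem_atomicDiagram (qψ.imp .falsum)]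
    exact ⟨hiff.symm, not_congr hiff.symm⟩
  have hmem : ∀ n y, y ∈ initialSegment h n → y ∈ A.atomicDiagram := fun n y hy => by
    obtain ⟨m, -, rfl⟩ := mem_initialSegment.1 hy
    exact hh ▸ ⟨m, rfl⟩
  refine turingReducible_of_search hG (fun n c y hy => ?_) fun c => ?_
  · by_cases hc : n ≤ c
    · simp [G, hc] at hy
    · simp only [G, length_initialSegment, if_neg hc, hFT n c (not_le.1 hc)] at hy
      split_ifs at hy with h₁ h₂ h₃ <;> obtain rfl := Option.some.inj hy
      · rw [charFun, if_neg (hzero c h₁)]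
      · rw [charFun, if_pos ((hpos c h₁).1.2 (hmem _ _ h₂))]
      · rw [charFun, if_neg ((hpos c h₁).2.2 (hmem _ _ h₃))]
  · by_cases h0 : T c = 0
    · exact ⟨c + 1, by simp [G, hFT, h0]⟩
    · have hex : ∃ m, h m = T c - 1 ∨ h m = Nat.pair 3 (Nat.pair (T c - 1) 0) := by
        by_cases hc : c ∈ B.atomicDiagram
        · have := (hpos c h0).1.1 hc
          rw [← hh] at this
          exact this.imp fun _ => .inl
        · have := (hpos c h0).2.1 hc
          rw [← hh] at this
          exact this.imp fun _ => .inr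
      obtain ⟨m, hm⟩ := hex
      have hcn : c < max (c + 1) (m + 1) := lt_max_of_lt_left (Nat.lt_succ_self c)
      have hmn : h m ∈ initialSegment h (max (c + 1) (m + 1)) :=
        mem_initialSegment.2 ⟨m, lt_max_of_lt_right (Nat.lt_succ_self m), rfl⟩
      refine ⟨max (c + 1) (m + 1), ?_⟩
      simp only [G, length_initialSegment, if_neg (not_le.2 hcn), hFT _ c hcn, if_neg h0]
      rcases hm with hm | hm
      · rw [if_pos (hm ▸ hmn)]
        rfl
      · rw [if_pos (c := Nat.pair 3 _ ∈ _) (hm ▸ hmn)]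
        split_ifs <;> rfl

end OmegaStructure

/-! ### Enumerations -/

theorem exists_code_dom_iff {E : ℕ → ℕ → Prop} (hE : REPred fun p : ℕ × ℕ => E p.1 p.2) :
    ∃ c : Nat.Partrec.Code, ∀ y u, (c.eval (Nat.pair y u)).Dom ↔ E y u := by
  obtain ⟨c, hc⟩ := Nat.Partrec.Code.exists_code.1 hE
  refine ⟨c, fun y u => ?_⟩
  have : Encodable.decode (α := ℕ × ℕ) (Nat.pair y u) = some (y, u) := Encodable.encodek (y, u)
  simp only [hc, this, Part.coe_some, Part.bind_some]
  simp [Part.assert]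

theorem primrecRel_testBit : PrimrecRel fun u n : ℕ => u.testBit n = true := by
  have hpow : Primrec fun p : ℕ × ℕ => 2 ^ p.2 :=
    (Primrec.nat_rec' Primrec.snd (.const 1)
      (Primrec.nat_mul.comp (Primrec.snd.comp Primrec.snd) (.const 2)).to₂).of_eq fun p => by
        induction p.2 with
        | zero => rfl
        | succ n ih => rw [pow_succ, ← ih]
  refine (Primrec.eq.comp (Primrec.nat_mod.comp (Primrec.nat_div.comp Primrec.fst hpow)
    (.const 2)) (.const 1)).of_eq fun p => ?_
  simp only [Nat.testBit_eq_decide_div_mod_eq, decide_eq_true_iff]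

theorem lt_of_mem_canonicalFiniteSet {u i : ℕ} (h : i ∈ canonicalFiniteSet u) : i < u :=
  Nat.lt_two_pow_self.trans_le (Nat.ge_two_pow_of_testBit h)

theorem primrecRel_canonicalFiniteSet_subset :
    PrimrecRel fun (u : ℕ) (σ : List ℕ) => canonicalFiniteSet u ⊆ {i | i ∈ σ} := by
  have hR : PrimrecRel fun (i : ℕ) (q : ℕ × List ℕ) => ¬(q.1.testBit i = true ∧ i ∉ q.2) :=
    (((primrecRel_testBit.comp (Primrec.fst.comp Primrec.snd) Primrec.fst).and
      (PrimrecPred.mem_list (Primrec.snd.comp Primrec.snd) Primrec.fst).not)).not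
  refine (hR.forall_mem_list.comp (Primrec.list_range.comp Primrec.fst)
    (Primrec.fst.pair Primrec.snd)).of_eq fun p => ⟨fun h i hi => ?_, ?_⟩
  · by_contra hσ
    exact h i (List.mem_range.2 (lt_of_mem_canonicalFiniteSet hi)) ⟨hi, hσ⟩
  · rintro h i - ⟨hi, hσ⟩
    exact hσ (h hi)

/-- A nonempty set enumeration reducible to the range of `f` has an enumeration computable
from `f`. -/
theorem EnumReducible.exists_enumeration {Y : Set ℕ} {f : ℕ → ℕ} (hne : Y.Nonempty)
    (hY : EnumReducible Y (Set.range f)) :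
    ∃ h : ℕ → ℕ, (h : ℕ →. ℕ) ≤ᵀ (f : ℕ →. ℕ) ∧ IsEnumeration h Y := by
  obtain ⟨E, hE, hiff⟩ := hY
  obtain ⟨c, hc⟩ := exists_code_dom_iff hE
  obtain ⟨y₀, hy₀⟩ := hne
  -- `m` codes a number `y`, the index `u` of a finite set and a bound for the length of the
  -- computation which shows that `E y u`
  let ok : List ℕ → ℕ → Prop := fun σ m =>
    (Nat.Partrec.Code.evaln m.unpair.2.unpair.2 c
      (Nat.pair m.unpair.1 m.unpair.2.unpair.1)).isSome = true ∧
    canonicalFiniteSet m.unpair.2.unpair.1 ⊆ {i | i ∈ σ}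
  have hok : PrimrecRel ok := by
    have hm : Primrec fun p : List ℕ × ℕ => p.2 := Primrec.snd
    have hev := Nat.Partrec.Code.primrec_evaln.comp ((hm.unpairSnd.unpairSnd.pair
      (Primrec.const c)).pair (Primrec₂.natPair.comp hm.unpairFst hm.unpairSnd.unpairFst))
    exact (Primrec.eq.comp (Primrec.option_isSome.comp hev) (.const true)).and
      (primrecRel_canonicalFiniteSet_subset.comp hm.unpairSnd.unpairFst Primrec.fst)
  classical
  let h : ℕ → ℕ := fun m => if ok (initialSegment f m) m then m.unpair.1 else y₀
  refine ⟨h, ?_, ?_⟩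
  · let G : List ℕ → ℕ → Option ℕ := fun σ m =>
      if σ.length = m then some (if ok σ m then m.unpair.1 else y₀) else none
    have hG : Computable₂ G :=
      (Primrec.ite (Primrec.eq.comp (Primrec.list_length.comp Primrec.fst) Primrec.snd)
        (Primrec.option_some.comp (Primrec.ite hok Primrec.snd.unpairFst (.const y₀)))
        (.const none)).to_comp.to₂
    refine turingReducible_of_search hG (fun n m y hy => ?_) fun m => ⟨m, by simp [G]⟩
    simp only [G, length_initialSegment] at hy
    split_ifs at hy with h₁ h₂
    · subst h₁
      rw [← Option.some.inj hy]
      exact (if_pos h₂).symm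
    · subst h₁
      rw [← Option.some.inj hy]
      exact (if_neg h₂).symm
  · refine Set.Subset.antisymm ?_ fun y hy => ?_
    · rintro _ ⟨m, rfl⟩
      simp only [h]
      split_ifs with hm
      · obtain ⟨hev, hD⟩ := hm
        obtain ⟨z, hz⟩ := Option.isSome_iff_exists.1 hev
        refine (hiff _).2 ⟨m.unpair.2.unpair.1, ?_, (hc _ _).1 (Part.dom_iff_mem.2
          ⟨z, Nat.Partrec.Code.evaln_sound hz⟩)⟩
        intro i hi
        obtain ⟨j, -, hj⟩ := mem_initialSegment.1 (hD hi)
        exact ⟨j, hj⟩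
      · exact hy₀
    · obtain ⟨u, hu, hE⟩ := (hiff y).1 hy
      obtain ⟨z, hz⟩ := Part.dom_iff_mem.1 ((hc y u).2 hE)
      obtain ⟨k, hk⟩ := Nat.Partrec.Code.evaln_complete.1 hz
      -- an initial segment of `f` long enough to enumerate the finite set
      have : ∃ n, canonicalFiniteSet u ⊆ {i | i ∈ initialSegment f n} := by
        have hex : ∀ i, ∃ j, i ∈ canonicalFiniteSet u → f j = i := fun i => by
          by_cases hi : i ∈ canonicalFiniteSet u
          · exact (hu hi).imp fun _ h _ => h
          · exact ⟨0, fun h => absurd h hi⟩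
        choose j hj using hex
        refine ⟨(Finset.range u).sup j + 1, fun i hi => mem_initialSegment.2 ⟨j i, ?_, hj i hi⟩⟩
        exact Nat.lt_succ_of_le (Finset.le_sup (Finset.mem_range.2
          (lt_of_mem_canonicalFiniteSet hi)))
      obtain ⟨n, hn⟩ := this
      refine ⟨Nat.pair y (Nat.pair u (max k n)), if_pos ⟨?_, ?_⟩ |>.trans (by simp)⟩
      · have := Nat.Partrec.Code.evaln_mono (le_max_left k n) hk
        simp only [Nat.unpair_pair]
        exact Option.isSome_iff_exists.2 ⟨z, this⟩
      · simp only [Nat.unpair_pair]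
        intro i hi
        refine (initialSegment_prefix f ?_).subset (hn hi)
        exact (le_max_right k n).trans ((Nat.right_le_pair _ _).trans (Nat.right_le_pair _ _))

/-- A nonempty set with computable characteristic function has a computable enumeration. -/
theorem exists_computable_enumeration {S : Set ℕ} (hne : S.Nonempty)
    (hS : Computable (charFun S)) : ∃ f : ℕ → ℕ, Computable f ∧ IsEnumeration f S := by
  classical
  obtain ⟨s, hs⟩ := hne
  refine ⟨fun n => if charFun S n = 1 then n else s, ?_, ?_⟩
  · have : Primrec fun p : ℕ × ℕ => if p.2 = 1 then p.1 else s :=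
      Primrec.ite (Primrec.eq.comp Primrec.snd (.const 1)) Primrec.fst (.const s)
    exact this.to_comp.comp (Computable.id.pair hS)
  · have hmem : ∀ n, charFun S n = 1 ↔ n ∈ S := fun n => by
      simp [charFun]
    refine Set.Subset.antisymm ?_ fun n hn => ⟨n, if_pos ((hmem n).2 hn)⟩
    rintro _ ⟨n, rfl⟩
    dsimp only
    split_ifs with h
    · exact (hmem n).1 h
    · exact hs

theorem _root_.TuringReducible.computable {g f : ℕ → ℕ} (hgf : (g : ℕ →. ℕ) ≤ᵀ (f : ℕ →. ℕ))
    (hf : Computable f) : Computable g :=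
  RecursiveIn.partrec_of_oracle (by rintro _ rfl; exact hf) hgf

theorem OmegaStructure.atomicDiagram_nonempty {L : FirstOrder.Language.{u, v}}
    [∀ n, Encodable (L.Functions n)] [∀ n, Encodable (L.Relations n)] (A : OmegaStructure L) :
    A.atomicDiagram.Nonempty :=
  ⟨_, FirstOrder.Language.BoundedFormula.falsum.imp .falsum, .imp .falsum .falsum, id, rfl⟩

theorem OmegaStructure.degree_le_iff {L : FirstOrder.Language.{u, v}}
    [∀ n, Encodable (L.Functions n)] [∀ n, Encodable (L.Relations n)] {A B : OmegaStructure L} :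
    A.degree ≤ B.degree ↔
      (charFun A.atomicDiagram : ℕ →. ℕ) ≤ᵀ (charFun B.atomicDiagram : ℕ →. ℕ) :=
  Iff.rfl

end ComputableStructures

/-! ### A structure whose isomorphism type has no degree -/

theorem mainTheorem6 {L : FirstOrder.Language.{u, v}} [Finite L.Symbols]
    [∀ n, Encodable (L.Functions n)] [∀ n, Encodable (L.Relations n)]
    -- a class of countable structures, closed under isomorphism
    (C : Set (CategoryTheory.Bundled.{0} L.Structure))
    (hcountable : ∀ M ∈ C, Countable M)
    (hiso : ∀ M N : CategoryTheory.Bundled.{0} L.Structure,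
      M ∈ C → Nonempty (M ≃[L] N) → N ∈ C)
    -- a computable sequence of structures in the class
    (Aseq : ℕ → ComputableStructures.OmegaStructure L)
    (hseqC : ∀ i, (Aseq i).toBundled ∈ C)
    (hseqComp : ComputableStructures.OmegaStructure.ComputableSequence Aseq)
    -- a finitely generated common substructure
    (A : ComputableStructures.OmegaStructure L)
    (hAC : A.toBundled ∈ C)
    (hAfg : FirstOrder.Language.Structure.FG L A.dom)
    (hAsub : ∀ i, A.IsSubstructure (Aseq i))
    -- the structures attached to the sets of natural numbers
    (AX : Set ℕ → ComputableStructures.OmegaStructure L)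
    (hAXC : ∀ X, (AX X).toBundled ∈ C)
    (hAXsub : ∀ X, A.IsSubstructure (AX X))
    (hAXenum : ∀ X, ComputableStructures.EnumReducible (AX X).atomicDiagram X)
    (hAXembed : ∀ X i,
      (∃ σ : (Aseq i).dom ↪[L] (AX X).dom, ∀ a : (Aseq i).dom, (a : ℕ) ∈ A.dom → (σ a : ℕ) = a) ↔ i ∈ X)
    -- from any enumeration of a copy one can compute an enumeration of the indices embeddable in it
    (hcopy : ∀ (X : Set ℕ) (B : ComputableStructures.OmegaStructure L)
      (τ : (AX X).dom ≃[L] B.dom) (f : ℕ → ℕ),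
      ComputableStructures.IsEnumeration f B.atomicDiagram →
      ComputableStructures.EnumerableFrom f
        {i | ∃ σ : (Aseq i).dom ↪[L] B.dom,
          ∀ a : (Aseq i).dom, (a : ℕ) ∈ A.dom → (τ.symm (σ a) : ℕ) = a}) :
    ∃ M ∈ C, ¬ ∃ d, ComputableStructures.IsDegreeOfIsomorphismType M d := by
  obtain ⟨f, g, hfg, hX, hmin⟩ := ComputableStructures.exists_minimal_pair_of_enumerations
  refine ⟨(AX (Set.range f)).toBundled, hAXC _, ?_⟩
  rintro ⟨_, ⟨B, ⟨i⟩, rfl⟩, hleast⟩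
  -- a copy of least degree is computable from every enumeration of `Set.range f`
  have hbelow : ∀ k : ℕ → ℕ, Set.range k = Set.range f →
      (ComputableStructures.charFun B.atomicDiagram : ℕ →. ℕ) ≤ᵀ (k : ℕ →. ℕ) := by
    intro k hk
    obtain ⟨h, hhk, hh⟩ := ComputableStructures.EnumReducible.exists_enumeration
      (AX (Set.range f)).atomicDiagram_nonempty (f := k) (by rw [hk]; exact hAXenum _)
    obtain ⟨B', ⟨j⟩, hB'⟩ := ComputableStructures.OmegaStructure.exists_copy_turingReducible hh
    have hle : B.degree ≤ B'.degree := hleast ⟨B', ⟨j⟩, rfl⟩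
    exact ((ComputableStructures.OmegaStructure.degree_le_iff.1 hle).trans hB').trans hhk
  have hcomp := hmin _ (hbelow f rfl) (hbelow g hfg.symm)
  obtain ⟨k, hk, hkB⟩ :=
    ComputableStructures.exists_computable_enumeration B.atomicDiagram_nonempty hcomp
  -- the indices of the structures which embed into the copy over `A` form the set itself
  let τ : (AX (Set.range f)).dom ≃[L] B.dom := FirstOrder.Language.Equiv.symm i
  have hset : {n | ∃ σ : (Aseq n).dom ↪[L] B.dom,
      ∀ a : (Aseq n).dom, (a : ℕ) ∈ A.dom → (τ.symm (σ a) : ℕ) = a} = Set.range f := by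
    ext n
    rw [← hAXembed (Set.range f) n]
    constructor
    · rintro ⟨σ, hσ⟩
      exact ⟨τ.symm.toEmbedding.comp σ, hσ⟩
    · rintro ⟨σ, hσ⟩
      refine ⟨τ.toEmbedding.comp σ, fun a ha => ?_⟩
      rw [← hσ a ha]
      exact congrArg Subtype.val (τ.symm_apply_apply (σ a))
  have henum := hcopy (Set.range f) B τ k hkB
  rw [hset] at henum
  rcases henum with hempty | ⟨h, hhk, hh⟩
  · exact (Set.range_nonempty f).ne_empty hempty
  · exact hX h (TuringReducible.computable hhk hk) hh
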